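/- Let $K$ be a field, $d\ge 1$ an integer, $S=K[t_0,\dots,t_d]$, and let $P\subset S$ be the ideal of the rational normal curve, i.e. the kernel of the $K$-algebra map $S\to K[x,y]$, $t_i\mapsto x^{d-i}y^i$. For $a\in\mathbb Q_{\ge 0}^{d+1}$ let $\operatorname{in}_a(P)$ be the ideal generated by the initial forms (the sums of the terms of maximal $a$-weight) of the nonzero elements of $P$. Let $I$ be a monomial initial ideal of $P$, i.e. $I=\operatorname{in}_\tau(P)$ for some term order $\tau$, and let $$C_I=\{a\in\mathbb Q_{\ge 0}^{d+1} : \operatorname{in}_\tau(\operatorname{in}_a(P))=I\}$$ be the corresponding closed cone of the Gröbner fan of $P$ (where $\tau$ is any term order with $\operatorname{in}_\tau(P)=I$). For an $(x,y)$-primary monomial ideal $L$ of $R=K[x,y]$ with $x^d\in L$, its associated sequence is $a=(a_0,\dots,a_d)$ with $a_i=\min\{j : x^{d-i}y^j\in L\}$. The $h$-polynomial of $L$ is the polynomial $h_L(z)\in\mathbb Z[z]$ with $\sum_{k\ge0}\dim_K(R/L^{k+1})z^k=h_L(z)/(1-z)^3$, and the Hilbert polynomials $P_L$ and $P^1_L$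 are the polynomials which agree, for all large $k$, with $\dim_K(L^k/L^{k+1})$ and $\dim_K(R/L^{k+1})$ respectively. Then there are polynomials $h^I\in\mathbb Z[A,z]$ and $Q^I,Q^I_1\in\mathbb Q[A,z]$, linear in the variables $A=(A_0,\dots,A_d)$ and without constant term (homogeneous of degree $1$ in $A$), such that: 1. For every $(x,y)$-primary monomial ideal $L\ni x^d$ of $R$ whose associated sequence $a$ belongs to $C_I$, evaluating at $A=a$ turns $h^I$ into the $h$-polynomial of $L$, $Q^I$ into $P_L$, and $Q_1^I$ into $P_L^1$. 2. Let $\beta_{i,\alpha}=\dim_K\operatorname{Tor}^S_i(S/I,K)_\alpha$ be the multigraded Betti numbers of $S/I$, and write $|v|$ for the sum of the entries of $v$ and $A\cdot v=\sum_j A_jv_j$. Only finitely many $\beta_{i,\alpha}$ are nonzero, and in $\mathbb Q(z)[A]$ $$h^I=|A|\,(1+(d-1)z)+A\cdot\sum_{i\ge1}(-1)^i\sum_{\alpha}\beta_{i,\alpha}\,\frac{z^{|\alpha|-1}}{(1-z)^{d-2}}\,\alpha .$$ 3. A Stanley decomposition of $S/I$ is a finite set $\Omega$ of pairs $(\sigma,\tau)$,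 $\sigma\in\mathbb N^{d+1}$, $\tau\subseteq\{0,\dots,d\}$, such that $S/I=\bigoplus_{(\sigma,\tau)\in\Omega}t^\sigma K[t_i : i\in\tau]$ as $K$-vector spaces. Stanley decompositions of $S/I$ exist, and for every such $\Omega$, identifying $\tau$ with its $0/1$-vector, in $\mathbb Q(z)[A]$ $$h^I=A\cdot\sum_{(\sigma,\tau)\in\Omega}z^{|\sigma|-1}(1-z)^{2-|\tau|}\bigl(z\,\tau+(1-z)\,\sigma\bigr).$$ 4. $Q^I$ and $Q_1^I$ are obtained explicitly from $h^I$, and hence from the multigraded Betti numbers or from any Stanley decomposition: if $h^I=\sum_k h^I_k z^k$ with linear forms $h^I_k\in\mathbb Z[A]$, then $$Q^I=\sum_k h^I_k\,(z-k+1),\qquad Q^I_1=\sum_k h^I_k\,\frac{(z-k+2)(z-k+1)}{2}.$$ -/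

import Mathlib

noncomputable section

namespace GroebnerFan

open MvPolynomial

/-! ### Initial ideals and the cones of the Gröbner fan -/

section Initial

variable {K : Type*} [Field K] {ι : Type*}

/-- The initial form of `f` for the weight vector `a`: the sum of the terms of `f` of maximal
`a`-degree. -/
def initialForm (a : ι → ℚ≥0) (f : MvPolynomial ι K) : MvPolynomial ι K :=
  weightedHomogeneousComponent a (weightedTotalDegree a f) f

/-- The initial ideal of `J` with respect to the weight vector `a`. -/
def weightInitialIdeal (a : ι → ℚ≥0) (J : Ideal (MvPolynomial ι K)) :
    Ideal (MvPolynomial ι K) :=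
  Ideal.span {g | ∃ f ∈ J, f ≠ 0 ∧ g = initialForm a f}

/-- The initial ideal of `J` with respect to the term order `τ`. -/
def initialIdeal (τ : MonomialOrder.{_, 0} ι) (J : Ideal (MvPolynomial ι K)) :
    Ideal (MvPolynomial ι K) :=
  Ideal.span {g | ∃ f ∈ J, f ≠ 0 ∧ g = monomial (τ.degree f) 1}

/-- The closed cone, in the Gröbner fan of `J`, of the monomial initial ideal
`I = initialIdeal τ J`: the weight vectors `a` with `in_τ (in_a J) = I`. -/
def cone (τ : MonomialOrder.{_, 0} ι) (J : Ideal (MvPolynomial ι K)) : Set (ι → ℚ≥0) :=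
  {a | initialIdeal τ (weightInitialIdeal a J) = initialIdeal τ J}

/-- An ideal generated by monomials. -/
def IsMonomialIdeal (J : Ideal (MvPolynomial ι K)) : Prop :=
  ∃ s : Set (ι →₀ ℕ), J = Ideal.span ((fun e => monomial e (1 : K)) '' s)

end Initial

/-- The ideal `P` of the rational normal curve of degree `d`: the kernel of
`K[t_0, …, t_d] → K[x, y]`, `t_i ↦ x ^ (d - i) * y ^ i`. -/
def rationalNormalCurveIdeal (K : Type*) [Field K] (d : ℕ) :
    Ideal (MvPolynomial (Fin (d + 1)) K) :=
  RingHom.ker (aeval (fun i : Fin (d + 1) =>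
    (X 0 ^ (d - (i : ℕ)) * X 1 ^ (i : ℕ) : MvPolynomial (Fin 2) K)) :
      MvPolynomial (Fin (d + 1)) K →ₐ[K] MvPolynomial (Fin 2) K)

/-! ### Ideals of `K[x, y]` and their Hilbert functions -/

section Local

variable {K : Type*} [Field K]

/-- The sequence `a_i = min {j : x ^ (d - i) * y ^ j ∈ L}`, `i = 0, …, d`, of an ideal `L`. -/
def assocSeq (d : ℕ) (L : Ideal (MvPolynomial (Fin 2) K)) (i : Fin (d + 1)) : ℕ :=
  sInf {j : ℕ | (X 0 ^ (d - (i : ℕ)) * X 1 ^ j : MvPolynomial (Fin 2) K) ∈ L}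

/-- `H(L, k) = dim_K (L ^ k / L ^ (k + 1))`. -/
def hilbertFun (L : Ideal (MvPolynomial (Fin 2) K)) (k : ℕ) : ℕ :=
  Module.finrank K (↥(L ^ k) ⧸ (L ^ (k + 1)).submoduleOf (L ^ k))

/-- `H¹(L, k) = dim_K (R / L ^ (k + 1))`. -/
def hilbertFun₁ (L : Ideal (MvPolynomial (Fin 2) K)) (k : ℕ) : ℕ :=
  Module.finrank K (MvPolynomial (Fin 2) K ⧸ L ^ (k + 1))

/-- `p` is the `h`-polynomial of `L`: `∑ H¹(L, k) z ^ k = p(z) / (1 - z) ^ 3`. -/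
def IsHPolynomial (L : Ideal (MvPolynomial (Fin 2) K)) (p : Polynomial ℤ) : Prop :=
  (p : PowerSeries ℤ) =
    (1 - PowerSeries.X) ^ 3 * PowerSeries.mk (fun k => (hilbertFun₁ L k : ℤ))

/-- `q` is the Hilbert polynomial of the numerical function `H`: they agree for large `k`. -/
def IsHilbertPolynomial (H : ℕ → ℕ) (q : Polynomial ℚ) : Prop :=
  ∀ᶠ k : ℕ in Filter.atTop, (H k : ℚ) = q.eval (k : ℚ)

end Local

/-! ### Multigraded Betti numbers and Stanley decompositions of `S / I` -/

section Multigraded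

variable {K : Type*} [Field K] {n : ℕ}

/-- The component of degree `α` of `S / I`, for a monomial ideal `I`. -/
def quotComponent (I : Ideal (MvPolynomial (Fin n) K)) (α : Fin n →₀ ℕ) :
    Submodule K (MvPolynomial (Fin n) K ⧸ I) :=
  Submodule.span K {Ideal.Quotient.mk I (monomial α 1)}

/-- The multidegree of `e_F = e_{j_1} ∧ ⋯ ∧ e_{j_i}`, `F = {j_1 < ⋯ < j_i}`, in the Koszul
complex: the `0/1`-vector of `F`. -/
def zeroOne (F : Finset (Fin n)) : Fin n →₀ ℕ :=
  ∑ j ∈ F, Finsupp.single j 1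

/-- The differential of the Koszul complex `(S / I) ⊗ K(t_0, …, t_{n-1}; S)`, whose chains
`∑ c_F e_F` are written as functions `F ↦ c_F`. It is the linear map with
`∂ (m e_F) = ∑_{j ∈ F} (-1) ^ #{k ∈ F : k < j} t_j m e_{F \ j}`. -/
def koszulDiff (I : Ideal (MvPolynomial (Fin n) K)) :
    (Finset (Fin n) → MvPolynomial (Fin n) K ⧸ I) →ₗ[K]
      (Finset (Fin n) → MvPolynomial (Fin n) K ⧸ I) :=
  LinearMap.pi fun F => ∑ j ∈ Fᶜ, ((-1 : K) ^ (F.filter (· < j)).card) •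
    (LinearMap.mulLeft K (Ideal.Quotient.mk I (X j)) ∘ₗ LinearMap.proj (insert j F))

/-- The Koszul chains of homological degree `i` and multidegree `α`: the coefficient of `e_F`
vanishes unless `F` has `i` elements and lies in the component of degree `α - deg e_F`. -/
def koszulChains (I : Ideal (MvPolynomial (Fin n) K)) (i : ℕ) (α : Fin n →₀ ℕ) :
    Submodule K (Finset (Fin n) → MvPolynomial (Fin n) K ⧸ I) :=
  Submodule.pi Set.univ fun F =>
    if F.card = i ∧ zeroOne F ≤ α then quotComponent I (α - zeroOne F) else ⊥

/-- The Koszul cycles of homological degree `i` and multidegree `α`. -/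
def koszulCycles (I : Ideal (MvPolynomial (Fin n) K)) (i : ℕ) (α : Fin n →₀ ℕ) :
    Submodule K (Finset (Fin n) → MvPolynomial (Fin n) K ⧸ I) :=
  koszulChains I i α ⊓ LinearMap.ker (koszulDiff I)

/-- The Koszul boundaries of homological degree `i` and multidegree `α`. -/
def koszulBoundaries (I : Ideal (MvPolynomial (Fin n) K)) (i : ℕ) (α : Fin n →₀ ℕ) :
    Submodule K (Finset (Fin n) → MvPolynomial (Fin n) K ⧸ I) :=
  (koszulChains I (i + 1) α).map (koszulDiff I)

/-- The multigraded Betti number `β_{i,α}(S / I) = dim_K Tor_i^S(S / I, K)_α` of a monomial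
ideal `I`. `Tor` is computed with the multigraded free resolution of `K` over `S` given by the
Koszul complex on the variables. -/
def betti (I : Ideal (MvPolynomial (Fin n) K)) (i : ℕ) (α : Fin n →₀ ℕ) : ℕ :=
  Module.finrank K
    (↥(koszulCycles I i α) ⧸ (koszulBoundaries I i α).submoduleOf (koszulCycles I i α))

/-- The subspace `t ^ σ K[t_i : i ∈ τ]` of `S`. -/
def stanleySpace (K : Type*) [Field K] {n : ℕ} (ω : (Fin n →₀ ℕ) × Finset (Fin n)) :
    Submodule K (MvPolynomial (Fin n) K) :=
  (Subalgebra.toSubmodule (supported K (ω.2 : Set (Fin n)))).map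
    (LinearMap.mulLeft K (monomial ω.1 (1 : K)))

/-- `Ω` is a Stanley decomposition of `S / I`: each `t ^ σ K[t_i : i ∈ τ]` with `(σ, τ) ∈ Ω` maps
injectively to `S / I`, and `S / I` is the direct sum of the images. -/
def IsStanleyDecomposition (I : Ideal (MvPolynomial (Fin n) K))
    (Ω : Finset ((Fin n →₀ ℕ) × Finset (Fin n))) : Prop :=
  (∀ ω ∈ Ω, Set.InjOn (Ideal.Quotient.mkₐ K I) (stanleySpace K ω)) ∧
    DirectSum.IsInternal (fun ω : ↥Ω =>
      (stanleySpace K (ω : (Fin n →₀ ℕ) × Finset (Fin n))).map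
        (Ideal.Quotient.mkₐ K I).toLinearMap)

end Multigraded

/-! ### Linear forms in `A_0, …, A_d`. The ring `k[A, z]` is written as `k[z][A]`. -/

/-- The linear form `v · A = ∑ v_j A_j`. -/
def linForm {R : Type*} [CommSemiring R] {n : ℕ} (v : Fin n → R) : MvPolynomial (Fin n) R :=
  ∑ j, C (v j) * X j

/-- The value at `A = a` of a polynomial in `A` with coefficients in `k[z]`. -/
def evalAt {k : Type*} [CommRing k] {n : ℕ} (a : Fin n → ℕ)
    (f : MvPolynomial (Fin n) (Polynomial k)) : Polynomial k :=
  MvPolynomial.eval (fun j => (a j : Polynomial k)) f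

/-- A polynomial in `ℤ[z][A]` regarded as a polynomial in `ℚ(z)[A]`, where `ℚ(z)` is the field of
fractions of `ℤ[z]`. -/
def toRat {n : ℕ} (f : MvPolynomial (Fin n) (Polynomial ℤ)) : MvPolynomial (Fin n) (RatFunc ℤ) :=
  MvPolynomial.map (algebraMap (Polynomial ℤ) (RatFunc ℤ)) f

/-- The right hand side of the formula for `h` by multigraded Betti numbers. -/
def bettiExpression {K : Type*} [Field K] (d : ℕ)
    (I : Ideal (MvPolynomial (Fin (d + 1)) K)) : MvPolynomial (Fin (d + 1)) (RatFunc ℤ) :=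
  linForm (fun _ => 1 + ((d : RatFunc ℤ) - 1) * RatFunc.X) +
    ∑ᶠ p : {p : ℕ × (Fin (d + 1) →₀ ℕ) // 1 ≤ p.1}, linForm (fun j =>
      (-1) ^ p.1.1 * (betti I p.1.1 p.1.2 : RatFunc ℤ) *
        (RatFunc.X ^ ((p.1.2.degree : ℤ) - 1) / (1 - RatFunc.X) ^ ((d : ℤ) - 2)) *
        (p.1.2 j : RatFunc ℤ))

/-- The right hand side of the formula for `h` by a Stanley decomposition. -/
def stanleyExpression {n : ℕ} (Ω : Finset ((Fin n →₀ ℕ) × Finset (Fin n))) :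
    MvPolynomial (Fin n) (RatFunc ℤ) :=
  ∑ ω ∈ Ω, linForm (fun j =>
    RatFunc.X ^ ((ω.1.degree : ℤ) - 1) * (1 - RatFunc.X) ^ (2 - (ω.2.card : ℤ)) *
      (RatFunc.X * (zeroOne ω.2 j : RatFunc ℤ) + (1 - RatFunc.X) * (ω.1 j : RatFunc ℤ)))

/-- `∑_k h_k (z - k + 1)`, where `h = ∑_k h_k z ^ k` with linear forms `h_k` in `A`. -/
def hilbertExpression {n : ℕ} (h : MvPolynomial (Fin n) (Polynomial ℤ)) :
    MvPolynomial (Fin n) (Polynomial ℚ) :=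
  linForm fun j => (h.coeff (Finsupp.single j 1)).sum fun k c =>
    Polynomial.C (c : ℚ) * (Polynomial.X - (k : Polynomial ℚ) + 1)

/-- `∑_k h_k (z - k + 2) (z - k + 1) / 2`, where `h = ∑_k h_k z ^ k` with linear forms `h_k`
in `A`. -/
def hilbertExpression₁ {n : ℕ} (h : MvPolynomial (Fin n) (Polynomial ℤ)) :
    MvPolynomial (Fin n) (Polynomial ℚ) :=
  linForm fun j => (h.coeff (Finsupp.single j 1)).sum fun k c =>
    Polynomial.C ((c : ℚ) / 2) * ((Polynomial.X - (k : Polynomial ℚ) + 2) *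
      (Polynomial.X - (k : Polynomial ℚ) + 1))

end GroebnerFan

end

/-! Everything rests on one count. Write R = K[x, y]. The kernel P identifies two monomials of S
exactly when they have the same degree k and the same y-degree j (the exponent of y in the image).
Hence the monomials outside I = in_τ(P) are the τ-minimal ones in each such fibre: one for each pair
(k, j) with 0 ≤ j ≤ kd. If the sequence a of L lies in the cone of I, these standard monomials also
minimise the weight a·m in their fibre; otherwise a binomial of P would have the standard monomial
as its a-initial form (`weight_le_of_mem_cone`).

On the other side, L is generated by the x^(d-i) y^(a_i), so x^p y^q lies in L^k iff some exponent m
of degree k has y-degree at least kd - p and weight a·m at most q. The least weight is increasing in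
the y-degree, so column p of the staircase of L^k has as its height the weight of the standard
monomial with j = kd - p. Summing the columns, dim R/L^k is the sum of a·m over the standard
monomials t^m of degree k (`finrank_quotient_pow`). The set of these m depends only on I, so the
dimension is linear in a.

Thus z h_j = (1-z)^3 M_j, where M_j = ∑ m_j z^|m| over standard monomials is the result of applying
t_j ∂/∂t_j to the multigraded Hilbert series of S/I and then setting every t_i = z. Both formulas
for h are the Leibniz rule applied to a presentation of that series. For a Stanley decomposition the
series is a sum of terms t^σ / ∏_{i∈τ}(1-t_i); uniqueness of standard monomials forces |τ| ≤ 2, so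
(1-z)^3 clears the denominators and h is a polynomial. For Betti numbers, ∏(1-t_i) times the series
is the alternating sum of the β_{i,α} t^α, by the Euler characteristic of the Koszul complex; the
remaining term involves the ordinary Hilbert series (1+(d-1)z)/(1-z)^2.

The Hilbert polynomials come from expanding h/(1-z)^3 and h/(1-z)^2 by binomial coefficients. -/

noncomputable section

namespace GroebnerFan

open MvPolynomial

/-! ### Monomial ideals and their quotients -/

section MonomialIdeal

variable {K : Type*} [Field K] {σ : Type*}

/-- `I` is the monomial ideal spanned by the monomials with exponent in `U`. -/
def IsMonomialOn (I : Ideal (MvPolynomial σ K)) (U : Set (σ →₀ ℕ)) : Prop :=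
  ∀ f, f ∈ I ↔ ∀ m ∈ f.support, m ∈ U

theorem isMonomialOn_span (s : Set (σ →₀ ℕ)) :
    IsMonomialOn (Ideal.span ((fun e => monomial e (1 : K)) '' s)) {m | ∃ e ∈ s, e ≤ m} :=
  fun _ => mem_ideal_span_monomial_image

theorem isMonomialOn_span_of_isUpperSet {U : Set (σ →₀ ℕ)} (hU : IsUpperSet U) :
    IsMonomialOn (Ideal.span ((fun e => monomial e (1 : K)) '' U)) U := by
  convert isMonomialOn_span U
  ext m
  exact ⟨fun h => ⟨m, h, le_rfl⟩, fun ⟨e, he, hem⟩ => hU hem he⟩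

namespace IsMonomialOn

variable {I J : Ideal (MvPolynomial σ K)} {U V : Set (σ →₀ ℕ)}

theorem monomial_mem (hI : IsMonomialOn I U) (m : σ →₀ ℕ) : monomial m (1 : K) ∈ I ↔ m ∈ U := by
  classical
  rw [hI, support_monomial, if_neg one_ne_zero]
  simp

theorem isUpperSet (hI : IsMonomialOn I U) : IsUpperSet U := by
  intro m n hmn hm
  rw [← hI.monomial_mem] at hm ⊢
  have := I.mul_mem_left (monomial (n - m) 1) hm
  rwa [monomial_mul, tsub_add_cancel_of_le hmn, one_mul] at this

theorem mk_eq_mk (hI : IsMonomialOn I U) (f g : MvPolynomial σ K) :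
    Ideal.Quotient.mk I f = Ideal.Quotient.mk I g ↔ ∀ m ∉ U, coeff m f = coeff m g := by
  rw [Ideal.Quotient.mk_eq_mk_iff_sub_mem, hI]
  refine forall_congr' fun m => ?_
  rw [mem_support_iff, coeff_sub, not_imp_comm, ← sub_eq_zero (b := coeff m g)]

theorem mk_eq_zero (hI : IsMonomialOn I U) (f : MvPolynomial σ K) :
    Ideal.Quotient.mk I f = 0 ↔ ∀ m ∉ U, coeff m f = 0 := by
  rw [← map_zero (Ideal.Quotient.mk I), hI.mk_eq_mk]
  simp

theorem mk_monomial_eq_zero (hI : IsMonomialOn I U) (m : σ →₀ ℕ) :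
    Ideal.Quotient.mk I (monomial m (1 : K)) = 0 ↔ m ∈ U := by
  rw [Ideal.Quotient.eq_zero_iff_mem, hI.monomial_mem]

theorem eq_span (hI : IsMonomialOn I U) :
    I = Ideal.span ((fun e => monomial e (1 : K)) '' U) := by
  ext f
  rw [hI, isMonomialOn_span_of_isUpperSet hI.isUpperSet]

theorem mul (hI : IsMonomialOn I U) (hJ : IsMonomialOn J V) :
    IsMonomialOn (I * J) {m | ∃ u ∈ U, ∃ v ∈ V, u + v = m} := by
  classical
  have hup : IsUpperSet {m | ∃ u ∈ U, ∃ v ∈ V, u + v = m} := by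
    rintro _ n hn ⟨u, hu, v, hv, rfl⟩
    obtain ⟨w, rfl⟩ := exists_add_of_le hn
    exact ⟨u, hu, v + w, hJ.isUpperSet le_self_add hv, (add_assoc _ _ _).symm⟩
  convert isMonomialOn_span_of_isUpperSet (K := K) hup
  rw [hI.eq_span, hJ.eq_span, Ideal.span_mul_span']
  congr 1
  ext f
  simp only [Set.mem_mul, Set.mem_image, Set.mem_ofPred_eq]
  constructor
  · rintro ⟨_, ⟨u, hu, rfl⟩, _, ⟨v, hv, rfl⟩, rfl⟩
    exact ⟨u + v, ⟨u, hu, v, hv, rfl⟩, by simp [monomial_mul]⟩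
  · rintro ⟨_, ⟨u, hu, v, hv, rfl⟩, rfl⟩
    exact ⟨_, ⟨u, hu, rfl⟩, _, ⟨v, hv, rfl⟩, by simp [monomial_mul]⟩

/-- The monomials with exponent outside of `U` give coordinates on the quotient. -/
def quotientEquiv (hI : IsMonomialOn I U) (T : Finset (σ →₀ ℕ)) (hT : ∀ m, m ∈ T ↔ m ∉ U) :
    (MvPolynomial σ K ⧸ I) ≃ₗ[K] (T → K) :=
  have hker : I.restrictScalars K =
      LinearMap.ker (LinearMap.pi fun m : T => lcoeff K (m : σ →₀ ℕ)) := by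
    ext f
    rw [Submodule.restrictScalars_mem, ← Ideal.Quotient.eq_zero_iff_mem, hI.mk_eq_zero]
    simp [funext_iff, hT]
  have hsurj : Function.Surjective (LinearMap.pi fun m : T => lcoeff K (m : σ →₀ ℕ)) := by
    classical
    intro c
    refine ⟨∑ m : T, monomial (m : σ →₀ ℕ) (c m), funext fun m => ?_⟩
    simp [coeff_monomial]
  (Submodule.Quotient.restrictScalarsEquiv K I).symm ≪≫ₗ
    Submodule.quotEquivOfEq _ _ hker ≪≫ₗ LinearMap.quotKerEquivOfSurjective _ hsurj

theorem finite_quotient (hI : IsMonomialOn I U) (T : Finset (σ →₀ ℕ)) (hT : ∀ m, m ∈ T ↔ m ∉ U) :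
    Module.Finite K (MvPolynomial σ K ⧸ I) :=
  Module.Finite.equiv (hI.quotientEquiv T hT).symm

theorem finrank_quotient (hI : IsMonomialOn I U) (T : Finset (σ →₀ ℕ))
    (hT : ∀ m, m ∈ T ↔ m ∉ U) : Module.finrank K (MvPolynomial σ K ⧸ I) = T.card := by
  rw [(hI.quotientEquiv T hT).finrank_eq]
  simp

end IsMonomialOn

/-- Dickson's lemma: an upper set of exponents is stable under changes of large coordinates. -/
theorem exists_stable_bound [Finite σ] {U : Set (σ →₀ ℕ)} (hU : IsUpperSet U) :
    ∃ N : ℕ, ∀ (j : σ) (m : σ →₀ ℕ), N ≤ m j → m + Finsupp.single j 1 ∈ U → m ∈ U := by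
  classical
  have hfin : {m | Minimal (· ∈ U) m}.Finite :=
    WellQuasiOrderedLE.finite_of_isAntichain (setOfPred_minimal_antichain _)
  -- The bound dominates every coordinate of every minimal element. If m_j is at least that large, a
  -- minimal element below m + e_j is already below m.
  refine ⟨hfin.toFinset.sup fun m => m.degree, fun j m hm hmU => ?_⟩
  obtain ⟨u, hum, hu⟩ := exists_minimal_le_of_wellFoundedLT (· ∈ U) _ hmU
  refine hU (fun i => ?_) hu.prop
  by_cases hij : i = j
  · subst hij
    refine (Finsupp.le_degree i u).trans (le_trans ?_ hm)
    exact Finset.le_sup (f := fun m : σ →₀ ℕ => m.degree) (hfin.mem_toFinset.2 hu)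
  · have := hum i
    simpa [Finsupp.single_apply, Ne.symm hij] using this

theorem add_single_mem_iff {U : Set (σ →₀ ℕ)} (hU : IsUpperSet U) {N : ℕ}
    (hN : ∀ (j : σ) (m : σ →₀ ℕ), N ≤ m j → m + Finsupp.single j 1 ∈ U → m ∈ U)
    (j : σ) (m : σ →₀ ℕ) (hm : N ≤ m j) (l : ℕ) : m + Finsupp.single j l ∈ U ↔ m ∈ U := by
  refine ⟨fun h => ?_, fun h => hU le_self_add h⟩
  induction l with
  | zero => simpa using h
  | succ l ih =>
    rw [Finsupp.single_add, ← add_assoc] at h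
    exact ih (hN j _ (hm.trans (by simp)) h)

end MonomialIdeal

/-! ### Generating series of functions on exponents -/

section Series

variable {n : ℕ}

/-- The exponents of degree `k`. -/
def exponents (n k : ℕ) : Finset (Fin n →₀ ℕ) :=
  Finset.univ.finsuppAntidiag k

@[simp]
theorem mem_exponents {k : ℕ} {m : Fin n →₀ ℕ} : m ∈ exponents n k ↔ m.degree = k := by
  rw [exponents, Finset.mem_finsuppAntidiag, Finsupp.degree_eq_sum]
  simp

/-- The series `∑_m f(m) z ^ |m|`. -/
def genSeries : ((Fin n →₀ ℕ) → ℤ) →ₗ[ℤ] PowerSeries ℤ where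
  toFun f := PowerSeries.mk fun k => ∑ m ∈ exponents n k, f m
  map_add' f g := by ext; simp [Finset.sum_add_distrib]
  map_smul' c f := by ext; simp [-zsmul_eq_mul, map_zsmul, Finset.mul_sum]

/-- The series `∑_m m_j f(m) z ^ |m|`. -/
def momentSeries (j : Fin n) : ((Fin n →₀ ℕ) → ℤ) →ₗ[ℤ] PowerSeries ℤ where
  toFun f := genSeries fun m => (m j : ℤ) * f m
  map_add' f g := by rw [← map_add]; congr 1; ext; simp [mul_add]
  map_smul' c f := by rw [← map_smul]; congr 1; ext; simp [mul_left_comm]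

theorem coeff_genSeries (f : (Fin n →₀ ℕ) → ℤ) (k : ℕ) :
    PowerSeries.coeff k (genSeries f) = ∑ m ∈ exponents n k, f m :=
  PowerSeries.coeff_mk k fun k => ∑ m ∈ exponents n k, f m

theorem momentSeries_apply (j : Fin n) (f : (Fin n →₀ ℕ) → ℤ) :
    momentSeries j f = genSeries fun m => (m j : ℤ) * f m := rfl

/-- Multiplication of the multigraded series `∑_m f(m) t ^ m` by `t ^ s`. -/
def shift (s : Fin n →₀ ℕ) (f : (Fin n →₀ ℕ) → ℤ) (m : Fin n →₀ ℕ) : ℤ :=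
  if s ≤ m then f (m - s) else 0

theorem shift_zero (f : (Fin n →₀ ℕ) → ℤ) : shift 0 f = f := by
  ext m
  simp [shift]

theorem shift_shift (s t : Fin n →₀ ℕ) (f : (Fin n →₀ ℕ) → ℤ) :
    shift s (shift t f) = shift (s + t) f := by
  ext m
  simp only [shift]
  by_cases h : s + t ≤ m
  · have hs : s ≤ m := le_trans le_self_add h
    rw [if_pos hs, if_pos (le_tsub_of_add_le_left h), if_pos h, tsub_tsub]
  · rw [if_neg h]
    split_ifs with hs ht
    · exact absurd ((le_tsub_iff_left hs).1 ht) h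
    · rfl
    · rfl

theorem genSeries_shift (s : Fin n →₀ ℕ) (f : (Fin n →₀ ℕ) → ℤ) :
    genSeries (shift s f) = PowerSeries.X ^ s.degree * genSeries f := by
  ext k
  rw [PowerSeries.coeff_X_pow_mul', coeff_genSeries]
  simp only [shift, ← Finset.sum_filter]
  split_ifs with hk
  · rw [coeff_genSeries]
    refine Finset.sum_bij' (fun m _ => m - s) (fun m _ => m + s) ?_ ?_ ?_ ?_ ?_
    · intro m hm
      rw [Finset.mem_filter, mem_exponents] at hm
      rw [mem_exponents, ← hm.1]
      have := congrArg Finsupp.degree (tsub_add_cancel_of_le hm.2)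
      rw [map_add] at this
      omega
    · intro m hm
      rw [mem_exponents] at hm
      rw [Finset.mem_filter, mem_exponents, map_add, hm]
      exact ⟨by omega, le_add_self⟩
    · intro m hm
      exact tsub_add_cancel_of_le (Finset.mem_filter.1 hm).2
    · intro m _
      exact add_tsub_cancel_right _ _
    · intro m _
      rfl
  · refine Finset.sum_eq_zero fun m hm => ?_
    rw [Finset.mem_filter, mem_exponents] at hm
    exact absurd (hm.1 ▸ Finsupp.degree_mono hm.2) hk

/-- This is the Leibniz rule for t_j ∂/∂t_j on a product t^s · F, specialised to t_i = z: the
derivative of t^s contributes the factor s_j. -/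
theorem momentSeries_shift (j : Fin n) (s : Fin n →₀ ℕ) (f : (Fin n →₀ ℕ) → ℤ) :
    momentSeries j (shift s f) =
      PowerSeries.X ^ s.degree * (momentSeries j f + (s j : PowerSeries ℤ) * genSeries f) := by
  have : (fun m : Fin n →₀ ℕ => (m j : ℤ) * shift s f m) =
      shift s ((fun m => (m j : ℤ) * f m) + (s j : ℤ) • f) := by
    ext m
    simp only [shift]
    split_ifs with h
    · have : (m j : ℤ) = ((m - s) j : ℕ) + s j := by
        rw [Finsupp.tsub_apply, Nat.cast_sub (h j)]
        ring
      rw [this]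
      simp [add_mul]
    · simp
  rw [momentSeries_apply, this, genSeries_shift, map_add, map_smul, momentSeries_apply]
  simp

/-- The indicator function of the exponents supported on `τ`. -/
def coneIndicator (τ : Finset (Fin n)) (m : Fin n →₀ ℕ) : ℤ :=
  if m.support ⊆ τ then 1 else 0

/-- A monomial in the enlarged set of variables either avoids t_i or is divisible by it. As a
recursion this says (1 - t_i) H_{τ ∪ i} = H_τ, which drives the next two inductions. -/
theorem coneIndicator_insert {i : Fin n} {τ : Finset (Fin n)} (hi : i ∉ τ) :
    coneIndicator (insert i τ) =
      coneIndicator τ + shift (Finsupp.single i 1) (coneIndicator (insert i τ)) := by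
  ext m
  have h1 : m.support ⊆ τ ↔ m.support ⊆ insert i τ ∧ ¬ Finsupp.single i 1 ≤ m := by
    rw [Finsupp.single_le_iff, Finset.subset_insert_iff, not_le, Nat.lt_one_iff]
    constructor
    · intro h
      exact ⟨(Finset.erase_subset _ _).trans h,
        Finsupp.notMem_support_iff.1 fun h' => hi (h h')⟩
    · rintro ⟨h, h'⟩
      rwa [Finset.erase_eq_of_notMem (Finsupp.notMem_support_iff.2 h')] at h
  have h2 : Finsupp.single i 1 ≤ m →
      ((m - Finsupp.single i 1).support ⊆ insert i τ ↔ m.support ⊆ insert i τ) := by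
    intro h
    constructor
    · intro h' k hk
      by_cases hki : k = i
      · simp [hki]
      · refine h' ?_
        simpa [Finsupp.single_apply, Ne.symm hki] using hk
    · exact fun h' => (Finsupp.support_mono tsub_le_self).trans h'
  simp only [coneIndicator, shift, Pi.add_apply]
  by_cases hm : Finsupp.single i 1 ≤ m
  · simp [h1, hm, h2 hm]
  · simp [h1, hm]

theorem genSeries_coneIndicator (τ : Finset (Fin n)) :
    (1 - PowerSeries.X) ^ τ.card * genSeries (coneIndicator τ) = 1 := by
  induction τ using Finset.induction_on with
  | empty =>
    ext k
    rw [Finset.card_empty, pow_zero, one_mul, coeff_genSeries, PowerSeries.coeff_one]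
    have : ∀ m : Fin n →₀ ℕ, coneIndicator ∅ m = if m = 0 then 1 else 0 := by
      intro m
      simp [coneIndicator]
    simp [this, eq_comm]
  | insert i τ hi ih =>
    have h := congrArg genSeries (coneIndicator_insert hi)
    rw [map_add, genSeries_shift, Finsupp.degree_single, pow_one] at h
    rw [Finset.card_insert_of_notMem hi]
    linear_combination (1 - PowerSeries.X) ^ τ.card * h + ih

/-- Differentiating 1/∏_{i∈τ}(1 - t_i) raises the order of the pole by one, and gives zero when j ∉
τ. -/
theorem momentSeries_coneIndicator (j : Fin n) (τ : Finset (Fin n)) :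
    (1 - PowerSeries.X) ^ (τ.card + 1) * momentSeries j (coneIndicator τ) =
      (zeroOne τ j : PowerSeries ℤ) * PowerSeries.X := by
  induction τ using Finset.induction_on with
  | empty =>
    have : (fun m : Fin n →₀ ℕ => (m j : ℤ) * coneIndicator ∅ m) = 0 := by
      ext m
      by_cases hm : m = 0 <;> simp [coneIndicator, hm]
    rw [momentSeries_apply, this]
    simp [zeroOne]
  | insert i τ hi ih =>
    have h := congrArg (momentSeries j) (coneIndicator_insert hi)
    have h' := genSeries_coneIndicator (insert i τ)
    rw [map_add, momentSeries_shift, Finsupp.degree_single, pow_one] at h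
    have hz : zeroOne (insert i τ) = Finsupp.single i 1 + zeroOne τ := by
      rw [zeroOne, Finset.sum_insert hi, zeroOne]
    rw [Finset.card_insert_of_notMem hi] at h' ⊢
    rw [hz, Finsupp.add_apply, Nat.cast_add, add_mul, ← ih]
    linear_combination (1 - PowerSeries.X) ^ (τ.card + 1) * h +
      ((Finsupp.single i 1 j : ℕ) : PowerSeries ℤ) * PowerSeries.X * h'

/-- The coefficients of `∏_{i ∈ T} (1 - t_i) ∑_m f(m) t ^ m`. -/
def koszulDifference (T : Finset (Fin n)) (f : (Fin n →₀ ℕ) → ℤ) : (Fin n →₀ ℕ) → ℤ :=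
  ∑ F ∈ T.powerset, (-1 : ℤ) ^ F.card • shift (zeroOne F) f

theorem shift_sum_smul {ι : Type*} (s : Fin n →₀ ℕ) (A : Finset ι) (c : ι → ℤ)
    (f : ι → (Fin n →₀ ℕ) → ℤ) :
    shift s (∑ i ∈ A, c i • f i) = ∑ i ∈ A, c i • shift s (f i) := by
  ext m
  by_cases h : s ≤ m <;> simp [shift, h, Finset.sum_apply]

theorem koszulDifference_insert {i : Fin n} {T : Finset (Fin n)} (hi : i ∉ T)
    (f : (Fin n →₀ ℕ) → ℤ) :
    koszulDifference (insert i T) f =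
      koszulDifference T f - shift (Finsupp.single i 1) (koszulDifference T f) := by
  rw [koszulDifference, Finset.sum_powerset_insert hi, sub_eq_add_neg, koszulDifference,
    shift_sum_smul, ← Finset.sum_neg_distrib]
  congr 1
  refine Finset.sum_congr rfl fun F hF => ?_
  have hiF : i ∉ F := fun h => hi (Finset.mem_powerset.1 hF h)
  rw [Finset.card_insert_of_notMem hiF, shift_shift, pow_succ, mul_neg_one, neg_smul, zeroOne,
    Finset.sum_insert hiF, zeroOne]

theorem genSeries_koszulDifference (T : Finset (Fin n)) (f : (Fin n →₀ ℕ) → ℤ) :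
    genSeries (koszulDifference T f) = (1 - PowerSeries.X) ^ T.card * genSeries f := by
  induction T using Finset.induction_on with
  | empty => simp [koszulDifference, zeroOne, shift_zero]
  | insert i T hi ih =>
    rw [koszulDifference_insert hi, map_sub, genSeries_shift, ih, Finsupp.degree_single,
      Finset.card_insert_of_notMem hi]
    ring

/-- The Leibniz rule for ∏_{i∈T}(1 - t_i) · F. Since t_j ∂/∂t_j removes the factor 1 - t_j when j ∈
T, both sides carry an extra 1 - z to avoid a division. -/
theorem momentSeries_koszulDifference (j : Fin n) (T : Finset (Fin n))
    (f : (Fin n →₀ ℕ) → ℤ) :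
    (1 - PowerSeries.X) * momentSeries j (koszulDifference T f) =
      (1 - PowerSeries.X) ^ (T.card + 1) * momentSeries j f -
        (zeroOne T j : PowerSeries ℤ) * PowerSeries.X * (1 - PowerSeries.X) ^ T.card *
          genSeries f := by
  induction T using Finset.induction_on with
  | empty => simp [koszulDifference, zeroOne, shift_zero]
  | insert i T hi ih =>
    have hz : zeroOne (insert i T) = Finsupp.single i 1 + zeroOne T := by
      rw [zeroOne, Finset.sum_insert hi, zeroOne]
    rw [koszulDifference_insert hi, map_sub, momentSeries_shift, genSeries_koszulDifference,
      Finsupp.degree_single, Finset.card_insert_of_notMem hi, hz, Finsupp.add_apply,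
      Nat.cast_add]
    linear_combination (1 - PowerSeries.X) * ih

end Series

/-! ### Stanley decompositions -/

section Stanley

variable {n : ℕ}

/-- The exponents of the monomials in `t ^ σ K[t_i : i ∈ τ]`. -/
def coneSet (ω : (Fin n →₀ ℕ) × Finset (Fin n)) : Set (Fin n →₀ ℕ) :=
  {m | ω.1 ≤ m ∧ (m - ω.1).support ⊆ ω.2}

/-- `Ω` describes a partition of `T` into cones. -/
def IsConeDecomposition (T : Set (Fin n →₀ ℕ)) (Ω : Finset ((Fin n →₀ ℕ) × Finset (Fin n))) :
    Prop :=
  (∀ ω ∈ Ω, coneSet ω ⊆ T) ∧ ∀ m ∈ T, ∃! ω, ω ∈ Ω ∧ m ∈ coneSet ω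

theorem apex_mem_coneSet (ω : (Fin n →₀ ℕ) × Finset (Fin n)) : ω.1 ∈ coneSet ω := by
  simp [coneSet]

theorem IsConeDecomposition.union {S T : Set (Fin n →₀ ℕ)} (hST : Disjoint S T)
    {Ω Ω' : Finset ((Fin n →₀ ℕ) × Finset (Fin n))} [DecidableEq (Fin n →₀ ℕ)]
    (h : IsConeDecomposition S Ω) (h' : IsConeDecomposition T Ω') :
    IsConeDecomposition (S ∪ T) (Ω ∪ Ω') := by
  constructor
  · intro ω hω
    rcases Finset.mem_union.1 hω with hω | hω
    · exact (h.1 ω hω).trans Set.subset_union_left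
    · exact (h'.1 ω hω).trans Set.subset_union_right
  · rintro m (hm | hm)
    · obtain ⟨ω, ⟨hω, hmω⟩, huniq⟩ := h.2 m hm
      refine ⟨ω, ⟨Finset.mem_union_left _ hω, hmω⟩, fun ω' ⟨hω', hmω'⟩ => ?_⟩
      rcases Finset.mem_union.1 hω' with hω' | hω'
      · exact huniq ω' ⟨hω', hmω'⟩
      · exact absurd (h'.1 ω' hω' hmω') (Set.disjoint_left.1 hST hm)
    · obtain ⟨ω, ⟨hω, hmω⟩, huniq⟩ := h'.2 m hm
      refine ⟨ω, ⟨Finset.mem_union_right _ hω, hmω⟩, fun ω' ⟨hω', hmω'⟩ => ?_⟩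
      rcases Finset.mem_union.1 hω' with hω' | hω'
      · exact absurd hm (Set.disjoint_left.1 hST (h.1 ω' hω' hmω'))
      · exact huniq ω' ⟨hω', hmω'⟩

theorem mem_coneSet_iff (σ : Fin n →₀ ℕ) (τ : Finset (Fin n)) (m : Fin n →₀ ℕ) :
    m ∈ coneSet (σ, τ) ↔ ∀ i, σ i ≤ m i ∧ (i ∉ τ → m i = σ i) := by
  constructor
  · rintro ⟨h1, h2⟩ i
    refine ⟨h1 i, fun hi => ?_⟩
    have : (m - σ) i = 0 := Finsupp.notMem_support_iff.1 fun h => hi (h2 h)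
    have h3 := h1 i
    rw [Finsupp.tsub_apply] at this
    simp only at h3
    omega
  · intro h
    refine ⟨fun i => (h i).1, fun i hi => ?_⟩
    by_contra hiτ
    rw [Finsupp.mem_support_iff, Finsupp.tsub_apply] at hi
    exact hi (by simp [(h i).2 hiτ])

/-- Moving along a coordinate direction in which `U` is stable. -/
theorem update_mem_iff {U : Set (Fin n →₀ ℕ)} (hU : IsUpperSet U) {N : ℕ}
    (hN : ∀ (j : Fin n) (m : Fin n →₀ ℕ), N ≤ m j → m + Finsupp.single j 1 ∈ U → m ∈ U)
    (j : Fin n) (m : Fin n →₀ ℕ) (c : ℕ) (hc : N ≤ c) (hcm : c ≤ m j) :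
    m.update j c ∈ U ↔ m ∈ U := by
  have : m = m.update j c + Finsupp.single j (m j - c) := by
    ext i
    by_cases hi : i = j
    · subst hi
      simp
      omega
    · simp [hi]
  conv_rhs => rw [this]
  exact (add_single_mem_iff hU hN j _ (by simpa using hc) _).symm

/-- Induction on the free directions. In a new direction j, slices of constant m_j are cut off one
by one until the coordinate reaches the bound N of `exists_stable_bound`. Beyond it membership in U
no longer depends on m_j, so a decomposition of one slice becomes a decomposition of the rest once j
is added to every cone. -/
theorem exists_isConeDecomposition_coneSet {U : Set (Fin n →₀ ℕ)} (hU : IsUpperSet U)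
    (τ : Finset (Fin n)) (σ : Fin n →₀ ℕ) :
    ∃ Ω, IsConeDecomposition (coneSet (σ, τ) \ U) Ω := by
  classical
  obtain ⟨N, hN⟩ := exists_stable_bound hU
  induction τ using Finset.induction_on generalizing σ with
  | empty =>
    have hcone : ∀ m, m ∈ coneSet (σ, ∅) ↔ m = σ := by
      intro m
      rw [mem_coneSet_iff]
      constructor
      · exact fun h => Finsupp.ext fun i => (h i).2 (Finset.notMem_empty i)
      · rintro rfl i
        simp
    by_cases hσ : σ ∈ U
    · refine ⟨∅, by simp, ?_⟩
      rintro m ⟨hm, hmU⟩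
      rw [hcone] at hm
      exact absurd (hm ▸ hσ) hmU
    · refine ⟨{(σ, ∅)}, ?_, ?_⟩
      · intro ω hω m hm
        rw [Finset.mem_singleton.1 hω] at hm
        exact ⟨hm, by rwa [(hcone m).1 hm]⟩
      · rintro m ⟨hm, -⟩
        exact ⟨(σ, ∅), ⟨by simp, hm⟩, fun ω hω => Finset.mem_singleton.1 hω.1⟩
  | insert j τ hj ih =>
    -- The number k bounds how many slices remain below height N; at k = 0 the apex already lies in
    -- the stable range.
    have key : ∀ (k : ℕ) (σ : Fin n →₀ ℕ), N ≤ σ j + k →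
        ∃ Ω, IsConeDecomposition (coneSet (σ, insert j τ) \ U) Ω := by
      intro k
      induction k with
      | zero =>
        intro σ hσ
        rw [add_zero] at hσ
        obtain ⟨Ω, hΩ⟩ := ih σ
        have hωj : ∀ ω ∈ Ω, ω.1 j = σ j := fun ω hω =>
          ((mem_coneSet_iff _ _ _).1 (hΩ.1 ω hω (apex_mem_coneSet ω)).1 j).2 hj
        have hωτ : ∀ ω ∈ Ω, j ∉ ω.2 := by
          intro ω hω hjω
          have h1 : ω.1 + Finsupp.single j 1 ∈ coneSet ω := by
            rw [← Prod.mk.eta (p := ω), mem_coneSet_iff]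
            intro i
            refine ⟨by simp, fun hi => ?_⟩
            have : i ≠ j := fun h => hi (h ▸ hjω)
            simp [Ne.symm this]
          have h2 := ((mem_coneSet_iff _ _ _).1 (hΩ.1 ω hω h1).1 j).2 hj
          simp [hωj ω hω] at h2
        have hproj : ∀ ω ∈ Ω, ∀ m, m ∈ coneSet (ω.1, insert j ω.2) ↔
            σ j ≤ m j ∧ m.update j (σ j) ∈ coneSet ω := by
          intro ω hω m
          rw [← Prod.mk.eta (p := ω), mem_coneSet_iff, mem_coneSet_iff]
          constructor
          · intro h
            refine ⟨hωj ω hω ▸ (h j).1, fun i => ?_⟩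
            by_cases hi : i = j
            · subst hi
              simp [hωj ω hω]
            · simpa [hi] using h i
          · rintro ⟨h1, h⟩ i
            by_cases hi : i = j
            · subst hi
              simp [hωj ω hω, h1]
            · simpa [hi] using h i
        have hproj' : ∀ m, m ∈ coneSet (σ, insert j τ) \ U ↔
            σ j ≤ m j ∧ m.update j (σ j) ∈ coneSet (σ, τ) \ U := by
          intro m
          rw [Set.mem_sdiff, Set.mem_sdiff, mem_coneSet_iff, mem_coneSet_iff]
          constructor
          · rintro ⟨h, hmU⟩
            refine ⟨(h j).1, fun i => ?_, ?_⟩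
            · by_cases hi : i = j
              · subst hi
                simp
              · simpa [hi] using h i
            · rwa [update_mem_iff hU hN j m _ hσ (h j).1]
          · rintro ⟨h1, h, hmU⟩
            rw [update_mem_iff hU hN j m _ hσ h1] at hmU
            refine ⟨fun i => ?_, hmU⟩
            by_cases hi : i = j
            · subst hi
              simp [h1]
            · simpa [hi] using h i
        refine ⟨Ω.image fun ω => (ω.1, insert j ω.2), ?_, ?_⟩
        · intro ω' hω' m hm
          obtain ⟨ω, hω, rfl⟩ := Finset.mem_image.1 hω'
          rw [hproj ω hω] at hm
          exact (hproj' m).2 ⟨hm.1, hΩ.1 ω hω hm.2⟩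
        · intro m hm
          rw [hproj'] at hm
          obtain ⟨ω, ⟨hω, hmω⟩, huniq⟩ := hΩ.2 _ hm.2
          refine ⟨(ω.1, insert j ω.2),
            ⟨Finset.mem_image_of_mem _ hω, (hproj ω hω m).2 ⟨hm.1, hmω⟩⟩, ?_⟩
          rintro ω' ⟨hω', hmω'⟩
          obtain ⟨ω'', hω'', rfl⟩ := Finset.mem_image.1 hω'
          rw [hproj ω'' hω''] at hmω'
          rw [huniq ω'' ⟨hω'', hmω'.2⟩]
      | succ k ihk =>
        intro σ hσ
        obtain ⟨Ω, hΩ⟩ := ih σ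
        obtain ⟨Ω', hΩ'⟩ := ihk (σ + Finsupp.single j 1) (by simp; omega)
        have hsplit : coneSet (σ, insert j τ) \ U =
            coneSet (σ, τ) \ U ∪ coneSet (σ + Finsupp.single j 1, insert j τ) \ U := by
          rw [← Set.union_sdiff_distrib]
          congr 1
          ext m
          rw [Set.mem_union, mem_coneSet_iff, mem_coneSet_iff, mem_coneSet_iff]
          constructor
          · intro h
            by_cases hmj : m j = σ j
            · refine Or.inl fun i => ⟨(h i).1, fun hi => ?_⟩
              by_cases hij : i = j
              · rw [hij, hmj]
              · exact (h i).2 (by simp [hij, hi])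
            · refine Or.inr fun i => ?_
              by_cases hij : i = j
              · subst hij
                have := (h i).1
                simp
                omega
              · simpa [Finsupp.single_apply, Ne.symm hij] using h i
          · rintro (h | h) i
            · exact ⟨(h i).1, fun hi => (h i).2 fun h' => hi (Finset.mem_insert_of_mem h')⟩
            · by_cases hij : i = j
              · subst hij
                have := (h i).1
                simp at this ⊢
                omega
              · simpa [Finsupp.single_apply, Ne.symm hij] using h i
        refine ⟨Ω ∪ Ω', hsplit ▸ hΩ.union ?_ hΩ'⟩
        rw [Set.disjoint_left]
        rintro m ⟨h, -⟩ ⟨h', -⟩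
        have h1 := ((mem_coneSet_iff _ _ _).1 h j).2 hj
        have h2 := ((mem_coneSet_iff _ _ _).1 h' j).1
        simp at h2
        omega
    exact key N σ (by omega)

theorem exists_isConeDecomposition_compl {U : Set (Fin n →₀ ℕ)} (hU : IsUpperSet U) :
    ∃ Ω, IsConeDecomposition Uᶜ Ω := by
  obtain ⟨Ω, hΩ⟩ := exists_isConeDecomposition_coneSet hU Finset.univ 0
  refine ⟨Ω, ?_⟩
  convert hΩ using 1
  ext m
  simp [mem_coneSet_iff]

variable {K : Type*} [Field K]

theorem stanleySpace_eq (ω : (Fin n →₀ ℕ) × Finset (Fin n)) :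
    stanleySpace K ω = restrictSupport K (coneSet ω) := by
  have h : Subalgebra.toSubmodule (supported K (ω.2 : Set (Fin n))) =
      restrictSupport K {m | m.support ⊆ ω.2} := by
    ext f
    rw [Subalgebra.mem_toSubmodule, mem_supported, mem_restrictSupport_iff]
    constructor
    · intro h m hm i hi
      exact h ((mem_vars_iff_mem_support i).2 ⟨m, hm, hi⟩)
    · intro h i hi
      obtain ⟨m, hm, him⟩ := (mem_vars_iff_mem_support i).1 hi
      exact h hm him
  rw [stanleySpace, h, restrictSupport_eq_span, restrictSupport_eq_span, Submodule.map_span,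
    Set.image_image]
  congr 1
  ext f
  constructor
  · rintro ⟨m, hm, rfl⟩
    refine ⟨ω.1 + m, ⟨le_self_add, ?_⟩, by simp [monomial_mul]⟩
    rwa [add_tsub_cancel_left]
  · rintro ⟨m, hm, rfl⟩
    exact ⟨m - ω.1, hm.2, by simp [monomial_mul, add_tsub_cancel_of_le hm.1]⟩

variable {I : Ideal (MvPolynomial (Fin n) K)} {U : Set (Fin n →₀ ℕ)}

/-- The standard monomials form a basis of S/I and each Stanley space is spanned by monomials. Hence
injectivity keeps the cones off U, spanning covers its complement, and independence makes the cones
disjoint. -/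
theorem IsMonomialOn.isConeDecomposition (hI : IsMonomialOn I U)
    {Ω : Finset ((Fin n →₀ ℕ) × Finset (Fin n))} (hΩ : IsStanleyDecomposition I Ω) :
    IsConeDecomposition Uᶜ Ω := by
  have hmem : ∀ ω : Ω, ∀ m ∈ coneSet (ω : (Fin n →₀ ℕ) × Finset (Fin n)),
      monomial m (1 : K) ∈ stanleySpace K (ω : (Fin n →₀ ℕ) × Finset (Fin n)) := by
    intro ω m hm
    rw [stanleySpace_eq]
    exact (monomial_mem_restrictSupport K).2 (Or.inl hm)
  have hsub : ∀ ω ∈ Ω, coneSet ω ⊆ Uᶜ := by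
    intro ω hω m hm hmU
    have := hΩ.1 ω hω (hmem ⟨ω, hω⟩ m hm) (Submodule.zero_mem _) (by
      rw [map_zero]
      exact (hI.mk_monomial_eq_zero m).2 hmU)
    exact one_ne_zero (monomial_eq_zero.1 this)
  refine ⟨hsub, fun m hm => ?_⟩
  have hint := (DirectSum.isInternal_submodule_iff_iSupIndep_and_iSup_eq_top _).1 hΩ.2
  have hex : ∃ ω ∈ Ω, m ∈ coneSet ω := by
    have htop : Ideal.Quotient.mk I (monomial m 1) ∈
        ⨆ ω : Ω, (stanleySpace K (ω : (Fin n →₀ ℕ) × Finset (Fin n))).map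
          (Ideal.Quotient.mkₐ K I).toLinearMap := by
      rw [hint.2]
      trivial
    rw [← Submodule.map_iSup] at htop
    obtain ⟨g, hg, hgm⟩ := htop
    have hle : (⨆ ω : Ω, stanleySpace K (ω : (Fin n →₀ ℕ) × Finset (Fin n))) ≤
        restrictSupport K {m | ∃ ω ∈ Ω, m ∈ coneSet ω} := by
      refine iSup_le fun ω => ?_
      rw [stanleySpace_eq]
      exact restrictSupport_mono K fun m hm => ⟨ω, ω.2, hm⟩
    have hc := (hI.mk_eq_mk _ _).1 hgm m hm
    rw [coeff_monomial, if_pos rfl] at hc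
    exact (mem_restrictSupport_iff K).1 (hle hg) (mem_support_iff.2 (hc ▸ one_ne_zero))
  obtain ⟨ω, hω, hmω⟩ := hex
  refine ⟨ω, ⟨hω, hmω⟩, fun ω' ⟨hω', hmω'⟩ => ?_⟩
  by_contra hne
  have hdisj := hint.1.pairwiseDisjoint (i := ⟨ω', hω'⟩) (j := ⟨ω, hω⟩) (by simpa using hne)
  have := Submodule.disjoint_def.1 hdisj (Ideal.Quotient.mk I (monomial m 1))
    ⟨_, hmem ⟨ω', hω'⟩ m hmω', rfl⟩ ⟨_, hmem ⟨ω, hω⟩ m hmω, rfl⟩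
  exact hm ((hI.mk_monomial_eq_zero m).1 this)

theorem IsMonomialOn.isStanleyDecomposition (hI : IsMonomialOn I U)
    {Ω : Finset ((Fin n →₀ ℕ) × Finset (Fin n))} (hΩ : IsConeDecomposition Uᶜ Ω) :
    IsStanleyDecomposition I Ω := by
  constructor
  · intro ω hω f hf g hg hfg
    rw [stanleySpace_eq, SetLike.mem_coe, mem_restrictSupport_iff] at hf hg
    have h := (hI.mk_eq_mk f g).1 hfg
    ext m
    by_cases hm : m ∈ coneSet ω
    · exact h m (hΩ.1 ω hω hm)
    · rw [notMem_support_iff.1 fun h => hm (hf h), notMem_support_iff.1 fun h => hm (hg h)]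
  · rw [DirectSum.isInternal_submodule_iff_iSupIndep_and_iSup_eq_top]
    constructor
    · intro ω
      rw [Submodule.disjoint_def]
      rintro _ ⟨f, hf, rfl⟩ hx
      have hle : (⨆ ω' : Ω, ⨆ _ : ω' ≠ ω,
          (stanleySpace K (ω' : (Fin n →₀ ℕ) × Finset (Fin n))).map
            (Ideal.Quotient.mkₐ K I).toLinearMap) ≤
          (restrictSupport K (coneSet (ω : (Fin n →₀ ℕ) × Finset (Fin n)))ᶜ).map
            (Ideal.Quotient.mkₐ K I).toLinearMap := by
        refine iSup₂_le fun ω' hne => Submodule.map_mono ?_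
        rw [stanleySpace_eq]
        refine restrictSupport_mono K fun m hm hm' => hne ?_
        obtain ⟨_, -, huniq⟩ := hΩ.2 m (hΩ.1 ω ω.2 hm')
        exact Subtype.ext ((huniq _ ⟨ω'.2, hm⟩).trans (huniq _ ⟨ω.2, hm'⟩).symm)
      obtain ⟨g, hg, hgf⟩ := hle hx
      have h := (hI.mk_eq_mk g f).1 hgf
      rw [stanleySpace_eq] at hf
      refine (hI.mk_eq_zero f).2 fun m hm => ?_
      by_cases hmω : m ∈ coneSet (ω : (Fin n →₀ ℕ) × Finset (Fin n))
      · rw [← h m hm]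
        exact notMem_support_iff.1 fun h' => (mem_restrictSupport_iff K).1 hg h' hmω
      · exact notMem_support_iff.1 fun h' => hmω ((mem_restrictSupport_iff K).1 hf h')
    · rw [eq_top_iff]
      intro x _
      obtain ⟨f, rfl⟩ := Ideal.Quotient.mk_surjective x
      rw [f.as_sum, map_sum]
      refine Submodule.sum_mem _ fun m _ => ?_
      by_cases hm : m ∈ U
      · have : Ideal.Quotient.mk I (monomial m (coeff m f)) = 0 := by
          rw [Ideal.Quotient.eq_zero_iff_mem, hI]
          intro m' hm'
          rwa [Finset.mem_singleton.1 (support_monomial_subset hm')]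
        rw [this]
        exact Submodule.zero_mem _
      · obtain ⟨ω, ⟨hω, hmω⟩, -⟩ := hΩ.2 m hm
        refine Submodule.mem_iSup_of_mem ⟨ω, hω⟩ ⟨_, ?_, rfl⟩
        rw [stanleySpace_eq]
        exact (monomial_mem_restrictSupport K).2 (Or.inl hmω)

/-- The indicator function of the monomials outside of `U`. -/
def stdIndicator (U : Set (Fin n →₀ ℕ)) (m : Fin n →₀ ℕ) : ℤ := by
  classical exact if m ∈ U then 0 else 1

theorem IsConeDecomposition.stdIndicator_eq {Ω : Finset ((Fin n →₀ ℕ) × Finset (Fin n))}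
    (hΩ : IsConeDecomposition Uᶜ Ω) :
    stdIndicator U = ∑ ω ∈ Ω, shift ω.1 (coneIndicator ω.2) := by
  classical
  have h : ∀ (ω : (Fin n →₀ ℕ) × Finset (Fin n)) (m : Fin n →₀ ℕ), shift ω.1 (coneIndicator ω.2) m =
      if m ∈ coneSet ω then 1 else 0 := by
    intro ω m
    by_cases h1 : ω.1 ≤ m <;> simp [shift, coneIndicator, coneSet, h1]
  ext m
  rw [Finset.sum_apply, stdIndicator]
  simp only [h]
  split_ifs with hm
  · exact (Finset.sum_eq_zero fun ω hω => if_neg fun h' => hΩ.1 ω hω h' hm).symm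
  · obtain ⟨ω, ⟨hω, hmω⟩, huniq⟩ := hΩ.2 m hm
    rw [Finset.sum_eq_single_of_mem ω hω, if_pos hmω]
    intro ω' hω' hne
    exact if_neg fun h' => hne (huniq ω' ⟨hω', h'⟩)

end Stanley

/-! ### The Koszul complex and the multigraded Betti numbers -/

section Koszul

variable {K : Type*} [Field K] {n : ℕ} {I : Ideal (MvPolynomial (Fin n) K)}
  {U : Set (Fin n →₀ ℕ)}

theorem zeroOne_apply (F : Finset (Fin n)) (j : Fin n) : zeroOne F j = if j ∈ F then 1 else 0 := by
  rw [zeroOne, Finsupp.finsetSum_apply]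
  simp [Finsupp.single_apply]

theorem zeroOne_insert {F : Finset (Fin n)} {j : Fin n} (hj : j ∉ F) :
    zeroOne (insert j F) = Finsupp.single j 1 + zeroOne F := by
  rw [zeroOne, Finset.sum_insert hj, zeroOne]

theorem koszulDiff_apply (c : Finset (Fin n) → MvPolynomial (Fin n) K ⧸ I)
    (F : Finset (Fin n)) :
    koszulDiff I c F = ∑ j ∈ Fᶜ, ((-1 : K) ^ (F.filter (· < j)).card) •
      (Ideal.Quotient.mk I (X j) * c (insert j F)) := by
  simp [koszulDiff, LinearMap.sum_apply]

theorem card_filter_lt_insert {F : Finset (Fin n)} {j k : Fin n} (hj : j ∉ F) :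
    ((insert j F).filter (· < k)).card = (F.filter (· < k)).card + if j < k then 1 else 0 := by
  rw [Finset.filter_insert]
  split_ifs with h
  · rw [Finset.card_insert_of_notMem fun h' => hj (Finset.mem_filter.1 h').1]
  · rfl

/-- The contributions of (j, k) and (k, j) cancel. Inserting the smaller index first changes the
sign count for the larger one by one, while the opposite order changes nothing. -/
theorem koszulDiff_koszulDiff (c : Finset (Fin n) → MvPolynomial (Fin n) K ⧸ I) :
    koszulDiff I (koszulDiff I c) = 0 := by
  ext F
  simp only [koszulDiff_apply, Pi.zero_apply, Finset.mul_sum, Finset.smul_sum]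
  rw [Finset.sum_sigma']
  refine Finset.sum_involution (fun p _ => ⟨p.2, p.1⟩) ?_ ?_ ?_ ?_
  · rintro ⟨j, k⟩ h
    simp only [Finset.mem_sigma, Finset.mem_compl, Finset.mem_insert, not_or] at h
    obtain ⟨hj, hkj, hk⟩ := h
    simp only [mul_smul_comm, smul_smul, ← pow_add, card_filter_lt_insert hj,
      card_filter_lt_insert hk]
    rw [Finset.insert_comm k j, mul_left_comm (Ideal.Quotient.mk I (X k)), ← add_smul]
    rcases lt_or_gt_of_ne hkj with h | h
    · rw [if_pos h, if_neg h.not_gt]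
      convert zero_smul K _
      ring
    · rw [if_pos h, if_neg h.not_gt]
      convert zero_smul K _
      ring
  · rintro ⟨j, k⟩ h _ heq
    simp only [Finset.mem_sigma, Finset.mem_compl, Finset.mem_insert, not_or] at h
    exact h.2.1 (Sigma.mk.inj heq).1
  · rintro ⟨j, k⟩ h
    simp only [Finset.mem_sigma, Finset.mem_compl, Finset.mem_insert, not_or] at h ⊢
    exact ⟨h.2.2, Ne.symm h.2.1, h.1⟩
  · rintro ⟨j, k⟩ _
    rfl

theorem mem_quotComponent {α : Fin n →₀ ℕ} {v : MvPolynomial (Fin n) K ⧸ I} :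
    v ∈ quotComponent I α ↔ ∃ r : K, r • Ideal.Quotient.mk I (monomial α 1) = v :=
  Submodule.mem_span_singleton

theorem mk_X_mul (r : K) (j : Fin n) (α : Fin n →₀ ℕ) :
    Ideal.Quotient.mk I (X j) * (r • Ideal.Quotient.mk I (monomial α 1)) =
      r • Ideal.Quotient.mk I (monomial (Finsupp.single j 1 + α) 1) := by
  rw [mul_smul_comm, ← map_mul, X, monomial_mul, one_mul]

theorem mk_X_mul_mem {j : Fin n} {α : Fin n →₀ ℕ} {v : MvPolynomial (Fin n) K ⧸ I}
    (hv : v ∈ quotComponent I α) :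
    Ideal.Quotient.mk I (X j) * v ∈ quotComponent I (Finsupp.single j 1 + α) := by
  obtain ⟨r, rfl⟩ := mem_quotComponent.1 hv
  exact mem_quotComponent.2 ⟨r, (mk_X_mul r j α).symm⟩

/-- Each multigraded component is spanned by one monomial, so a class whose degree involves t_j can
be divided by t_j. This supplies the preimages under the Koszul differential below. -/
theorem exists_mk_X_mul_eq {j : Fin n} {α : Fin n →₀ ℕ} {v : MvPolynomial (Fin n) K ⧸ I}
    (hv : v ∈ quotComponent I (Finsupp.single j 1 + α)) :
    ∃ u ∈ quotComponent I α, Ideal.Quotient.mk I (X j) * u = v := by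
  obtain ⟨r, rfl⟩ := mem_quotComponent.1 hv
  exact ⟨_, mem_quotComponent.2 ⟨r, rfl⟩, mk_X_mul r j α⟩

theorem mem_koszulChains {i : ℕ} {α : Fin n →₀ ℕ}
    {c : Finset (Fin n) → MvPolynomial (Fin n) K ⧸ I} :
    c ∈ koszulChains I i α ↔ ∀ F, (F.card = i ∧ zeroOne F ≤ α → c F ∈ quotComponent I
      (α - zeroOne F)) ∧ (¬ (F.card = i ∧ zeroOne F ≤ α) → c F = 0) := by
  rw [koszulChains, Submodule.mem_pi]
  refine forall_congr' fun F => ?_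
  by_cases h : F.card = i ∧ zeroOne F ≤ α <;> simp [h]

theorem tsub_zeroOne_of_insert {α : Fin n →₀ ℕ} {F : Finset (Fin n)} {j : Fin n} (hj : j ∉ F)
    (h : zeroOne (insert j F) ≤ α) :
    α - zeroOne F = Finsupp.single j 1 + (α - zeroOne (insert j F)) := by
  obtain ⟨β, rfl⟩ := exists_add_of_le h
  rw [add_tsub_cancel_left, zeroOne_insert hj, add_right_comm, add_tsub_cancel_right]

theorem zeroOne_le_of_insert {α : Fin n →₀ ℕ} {F : Finset (Fin n)} {j : Fin n} (hj : j ∉ F)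
    (h : zeroOne (insert j F) ≤ α) : zeroOne F ≤ α := by
  rw [zeroOne_insert hj] at h
  exact le_add_self.trans h

theorem koszulDiff_mem {i : ℕ} {α : Fin n →₀ ℕ}
    {c : Finset (Fin n) → MvPolynomial (Fin n) K ⧸ I} (hc : c ∈ koszulChains I (i + 1) α) :
    koszulDiff I c ∈ koszulChains I i α := by
  rw [mem_koszulChains] at hc ⊢
  intro F
  rw [koszulDiff_apply]
  constructor
  · rintro ⟨hF, hFα⟩
    refine Submodule.sum_mem _ fun j hj => Submodule.smul_mem _ _ ?_
    rw [Finset.mem_compl] at hj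
    by_cases h : zeroOne (insert j F) ≤ α
    · rw [tsub_zeroOne_of_insert hj h]
      exact mk_X_mul_mem ((hc _).1 ⟨by rw [Finset.card_insert_of_notMem hj, hF], h⟩)
    · rw [(hc _).2 fun h' => h h'.2, mul_zero]
      exact Submodule.zero_mem _
  · intro h
    refine Finset.sum_eq_zero fun j hj => ?_
    rw [Finset.mem_compl] at hj
    rw [(hc _).2, mul_zero, smul_zero]
    rw [Finset.card_insert_of_notMem hj]
    exact fun h' => h ⟨by omega, zeroOne_le_of_insert hj h'.2⟩

theorem koszulBoundaries_le_chains (i : ℕ) (α : Fin n →₀ ℕ) :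
    koszulBoundaries I i α ≤ koszulChains I i α := by
  rintro _ ⟨c, hc, rfl⟩
  exact koszulDiff_mem hc

theorem koszulBoundaries_le_cycles (i : ℕ) (α : Fin n →₀ ℕ) :
    koszulBoundaries I i α ≤ koszulCycles I i α := by
  refine le_inf (koszulBoundaries_le_chains i α) ?_
  rintro _ ⟨c, -, rfl⟩
  exact koszulDiff_koszulDiff c

/-- A product of subspaces is equivalent to the corresponding subspace of the product. -/
def submodulePiEquiv {ι : Type*} {M : Type*} [AddCommGroup M] [Module K M]
    (p : ι → Submodule K M) : Submodule.pi Set.univ p ≃ₗ[K] (∀ i, p i) where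
  toFun c i := ⟨c.1 i, c.2 i trivial⟩
  invFun c := ⟨fun i => (c i).1, fun i _ => (c i).2⟩
  map_add' _ _ := rfl
  map_smul' _ _ := rfl

instance finite_quotComponent (α : Fin n →₀ ℕ) : Module.Finite K (quotComponent I α) :=
  Module.Finite.span_singleton K _

theorem finite_koszulChains_component (i : ℕ) (α : Fin n →₀ ℕ) (F : Finset (Fin n)) :
    Module.Finite K
      ↥(if F.card = i ∧ zeroOne F ≤ α then quotComponent I (α - zeroOne F) else ⊥) := by
  by_cases h : F.card = i ∧ zeroOne F ≤ α
  · rw [if_pos h]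
    infer_instance
  · rw [if_neg h]
    infer_instance

instance finite_koszulChains (i : ℕ) (α : Fin n →₀ ℕ) : Module.Finite K (koszulChains I i α) := by
  have := finite_koszulChains_component (I := I) i α
  exact Module.Finite.equiv (submodulePiEquiv _).symm

theorem IsMonomialOn.finrank_quotComponent (hI : IsMonomialOn I U) (α : Fin n →₀ ℕ) :
    (Module.finrank K (quotComponent I α) : ℤ) = stdIndicator U α := by
  rw [quotComponent, stdIndicator]
  split_ifs with h
  · rw [(hI.mk_monomial_eq_zero α).2 h, Submodule.span_zero_singleton]
    simp
  · rw [finrank_span_singleton fun h' => h ((hI.mk_monomial_eq_zero α).1 h')]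
    simp

theorem IsMonomialOn.finrank_koszulChains (hI : IsMonomialOn I U) (i : ℕ) (α : Fin n →₀ ℕ) :
    (Module.finrank K (koszulChains I i α) : ℤ) =
      ∑ F : Finset (Fin n), if F.card = i then shift (zeroOne F) (stdIndicator U) α else 0 := by
  have := finite_koszulChains_component (I := I) i α
  rw [koszulChains, (submodulePiEquiv _).finrank_eq, Module.finrank_pi_fintype, Nat.cast_sum]
  refine Finset.sum_congr rfl fun F _ => ?_
  by_cases h1 : F.card = i
  · by_cases h2 : zeroOne F ≤ α
    · rw [if_pos ⟨h1, h2⟩, if_pos h1, shift, if_pos h2, hI.finrank_quotComponent]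
    · rw [if_neg fun h => h2 h.2, if_pos h1, shift, if_neg h2]
      simp
  · rw [if_neg fun h => h1 h.1, if_neg h1]
    simp

theorem finrank_cycles_eq (i : ℕ) (α : Fin n →₀ ℕ) :
    Module.finrank K (koszulCycles I i α) =
      betti I i α + Module.finrank K (koszulBoundaries I i α) := by
  have : Module.Finite K (koszulCycles I i α) :=
    Submodule.finiteDimensional_of_le (inf_le_left : _ ≤ koszulChains I i α)
  rw [betti, ← (Submodule.submoduleOfEquivOfLe (koszulBoundaries_le_cycles i α)).finrank_eq,
    Submodule.finrank_quotient_add_finrank]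

theorem finrank_map_add_finrank_inf_ker {V W : Type*} [AddCommGroup V] [Module K V]
    [AddCommGroup W] [Module K W] (f : V →ₗ[K] W) (C : Submodule K V) [Module.Finite K C] :
    Module.finrank K (C.map f) + Module.finrank K ↥(C ⊓ LinearMap.ker f) =
      Module.finrank K C := by
  rw [← LinearMap.finrank_range_add_finrank_ker (f.domRestrict C), LinearMap.range_domRestrict]
  congr 1
  have : LinearMap.ker (f.domRestrict C) = (C ⊓ LinearMap.ker f).submoduleOf C := by
    ext x
    simp [Submodule.submoduleOf, LinearMap.domRestrict_apply]
  rw [this, (Submodule.submoduleOfEquivOfLe inf_le_left).finrank_eq]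

theorem finrank_chains_succ (i : ℕ) (α : Fin n →₀ ℕ) :
    Module.finrank K (koszulChains I (i + 1) α) =
      Module.finrank K (koszulBoundaries I i α) + Module.finrank K (koszulCycles I (i + 1) α) :=
  (finrank_map_add_finrank_inf_ker _ _).symm

theorem koszulCycles_zero (α : Fin n →₀ ℕ) : koszulCycles I 0 α = koszulChains I 0 α := by
  refine inf_eq_left.2 fun c hc => ?_
  rw [mem_koszulChains] at hc
  rw [LinearMap.mem_ker]
  ext F
  rw [koszulDiff_apply]
  refine Finset.sum_eq_zero fun j _ => ?_
  rw [(hc _).2, mul_zero, smul_zero]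
  exact fun h => Finset.insert_ne_empty j F (Finset.card_eq_zero.1 h.1)

theorem koszulChains_eq_bot {i : ℕ} (hi : n < i) (α : Fin n →₀ ℕ) : koszulChains I i α = ⊥ := by
  rw [eq_bot_iff]
  intro c hc
  rw [mem_koszulChains] at hc
  rw [Submodule.mem_bot]
  ext F
  refine (hc F).2 fun h => ?_
  have := F.card_le_univ
  rw [Fintype.card_fin] at this
  omega

theorem betti_eq_zero_of_le {i : ℕ} {α : Fin n →₀ ℕ}
    (h : koszulCycles I i α ≤ koszulBoundaries I i α) : betti I i α = 0 := by
  have := finrank_cycles_eq (I := I) i α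
  rw [le_antisymm h (koszulBoundaries_le_cycles i α)] at this
  omega

theorem betti_eq_zero_of_lt {i : ℕ} (hi : n < i) (α : Fin n →₀ ℕ) : betti I i α = 0 := by
  refine betti_eq_zero_of_le fun c hc => ?_
  have := hc.1
  rw [SetLike.mem_coe, koszulChains_eq_bot hi, Submodule.mem_bot] at this
  rw [this]
  exact Submodule.zero_mem _

/-- Each chain dimension splits into cycles and boundaries one degree lower, and cycles into
homology and boundaries. The boundary terms telescope and only the last one survives. -/
theorem sum_finrank_chains (α : Fin n →₀ ℕ) (N : ℕ) :
    ∑ i ∈ Finset.range (N + 1), (-1 : ℤ) ^ i * Module.finrank K (koszulChains I i α) =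
      ∑ i ∈ Finset.range (N + 1), (-1 : ℤ) ^ i * betti I i α +
        (-1) ^ N * Module.finrank K (koszulBoundaries I N α) := by
  induction N with
  | zero =>
    have := finrank_cycles_eq (I := I) 0 α
    rw [koszulCycles_zero] at this
    simp [this]
  | succ N ih =>
    rw [Finset.sum_range_succ, ih, Finset.sum_range_succ _ (N + 1), finrank_chains_succ,
      finrank_cycles_eq]
    push_cast
    ring

/-- The alternating sum of the Betti numbers is the Euler characteristic of the Koszul complex. -/
theorem IsMonomialOn.sum_betti (hI : IsMonomialOn I U) (α : Fin n →₀ ℕ) :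
    ∑ i ∈ Finset.range (n + 1), (-1 : ℤ) ^ i * betti I i α =
      koszulDifference Finset.univ (stdIndicator U) α := by
  have h := sum_finrank_chains (I := I) α n
  have hb : koszulBoundaries I n α = ⊥ := by
    rw [koszulBoundaries, koszulChains_eq_bot (Nat.lt_succ_self n), Submodule.map_bot]
  rw [hb, finrank_bot, Nat.cast_zero, mul_zero, add_zero] at h
  rw [← h, koszulDifference, Finset.powerset_univ, Finset.sum_apply]
  simp only [hI.finrank_koszulChains, Finset.mul_sum]
  rw [Finset.sum_comm]
  refine Finset.sum_congr rfl fun F _ => ?_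
  rw [Finset.sum_eq_single_of_mem F.card, if_pos rfl]
  · rfl
  · have := F.card_le_univ
    rw [Fintype.card_fin] at this
    exact Finset.mem_range.2 (by omega)
  · intro i _ hi
    rw [if_neg hi.symm, mul_zero]

/-- Tor_0 is S/(I + (t_0, …)), which lives in degree 0: a class of nonzero degree is divisible by
some t_j and so bounds a multiple of e_j. This lets the Betti sum start at i = 1. -/
theorem betti_zero_eq_zero {α : Fin n →₀ ℕ} (hα : α ≠ 0) : betti I 0 α = 0 := by
  obtain ⟨j, hj⟩ := Finsupp.ne_iff.1 hα
  refine betti_eq_zero_of_le fun c hc => ?_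
  have hc' := mem_koszulChains.1 hc.1
  have hα' : α = Finsupp.single j 1 + (α - Finsupp.single j 1) :=
    (add_tsub_cancel_of_le (Finsupp.single_le_iff.2 (Nat.one_le_iff_ne_zero.2 hj))).symm
  have h0 := (hc' ∅).1 ⟨rfl, by simp [zeroOne]⟩
  rw [show α - zeroOne ∅ = α by simp [zeroOne], hα'] at h0
  obtain ⟨u, hu, huc⟩ := exists_mk_X_mul_eq h0
  refine ⟨fun F => if F = {j} then u else 0, mem_koszulChains.2 fun F => ?_, ?_⟩
  · by_cases hF : F = {j}
    · subst hF
      have h1 : zeroOne {j} = Finsupp.single j 1 := by simp [zeroOne]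
      rw [if_pos rfl, h1]
      refine ⟨fun _ => hu, fun h => absurd ⟨Finset.card_singleton j, ?_⟩ h⟩
      exact Finsupp.single_le_iff.2 (Nat.one_le_iff_ne_zero.2 hj)
    · simp [hF]
  · ext F
    rw [koszulDiff_apply]
    by_cases hF : F = ∅
    · subst hF
      rw [Finset.sum_eq_single_of_mem j (by simp)]
      · simp [huc]
      · intro k _ hk
        simp [hk]
    · rw [(hc' F).2 fun h => hF (Finset.card_eq_zero.1 h.1)]
      refine Finset.sum_eq_zero fun k hk => ?_
      rw [if_neg, mul_zero, smul_zero]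
      intro h
      have := congrArg Finset.card h
      rw [Finset.card_insert_of_notMem (Finset.mem_compl.1 hk), Finset.card_singleton] at this
      exact hF (Finset.card_eq_zero.1 (by omega))

/-- When α_j exceeds the stable bound, multiplication by t_j is an isomorphism between the
components involved. Contracting along e_j, that is, sending c to e_j ∧ c / t_j, then shows that
every cycle is a boundary. -/
theorem IsMonomialOn.betti_eq_zero_of_large (hI : IsMonomialOn I U) {N : ℕ}
    (hN : ∀ (j : Fin n) (m : Fin n →₀ ℕ), N ≤ m j → m + Finsupp.single j 1 ∈ U → m ∈ U)
    (i : ℕ) {α : Fin n →₀ ℕ} {j : Fin n} (hj : N + 1 ≤ α j) : betti I i α = 0 := by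
  refine betti_eq_zero_of_le fun c hc => ?_
  have hc' := mem_koszulChains.1 hc.1
  have hle : ∀ G : Finset (Fin n), j ∉ G → zeroOne G ≤ α → zeroOne (insert j G) ≤ α := by
    intro G hG h k
    by_cases hkj : k = j
    · subst hkj
      rw [zeroOne_apply]
      split_ifs <;> omega
    · have := h k
      rw [zeroOne_apply] at this ⊢
      simpa [hkj] using this
  -- The candidate b is supported on the sets containing j, with t_j b_{G ∪ j} = ± c_G for j ∉ G;
  -- the sign makes ∂b agree with c on every G avoiding j.
  have hb : ∀ F : Finset (Fin n), ∃ v : MvPolynomial (Fin n) K ⧸ I,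
      (j ∉ F → v = 0) ∧ ((F.card = i + 1 ∧ zeroOne F ≤ α → v ∈ quotComponent I (α - zeroOne F)) ∧
        (¬ (F.card = i + 1 ∧ zeroOne F ≤ α) → v = 0)) ∧
      (j ∈ F → ((-1 : K) ^ ((F.erase j).filter (· < j)).card) •
        (Ideal.Quotient.mk I (X j) * v) = c (F.erase j)) := by
    intro F
    by_cases hjF : j ∈ F
    · obtain ⟨G, hjG, rfl⟩ : ∃ G, j ∉ G ∧ F = insert j G :=
        ⟨F.erase j, Finset.notMem_erase _ _, (Finset.insert_erase hjF).symm⟩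
      rw [Finset.erase_insert hjG, Finset.card_insert_of_notMem hjG]
      by_cases hG : G.card = i ∧ zeroOne G ≤ α
      · have h1 := (hc' G).1 hG
        rw [tsub_zeroOne_of_insert hjG (hle G hjG hG.2)] at h1
        obtain ⟨u, hu, huc⟩ := exists_mk_X_mul_eq h1
        refine ⟨((-1 : K) ^ (G.filter (· < j)).card) • u, fun h => absurd hjF h,
          ⟨fun _ => Submodule.smul_mem _ _ hu, fun h => absurd ⟨by rw [hG.1], hle G hjG hG.2⟩ h⟩,
          fun _ => ?_⟩
        rw [mul_smul_comm, smul_smul, ← pow_add, Even.neg_one_pow ⟨_, rfl⟩, one_smul, huc]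
      · exact ⟨0, fun _ => rfl, ⟨fun _ => Submodule.zero_mem _, fun _ => rfl⟩,
          fun _ => by rw [(hc' G).2 hG, mul_zero, smul_zero]⟩
    · exact ⟨0, fun _ => rfl, ⟨fun _ => Submodule.zero_mem _, fun _ => rfl⟩,
        fun h => absurd h hjF⟩
  choose b hb0 hbmem hbc using hb
  have hbch : b ∈ koszulChains I (i + 1) α := mem_koszulChains.2 hbmem
  refine ⟨b, hbch, ?_⟩
  rw [← sub_eq_zero]
  -- The error e is a cycle vanishing on all sets without j. Its boundary at G is therefore ± t_j
  -- e_{G ∪ j}, and injectivity of t_j gives e = 0.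
  set e := koszulDiff I b - c with he
  have hech : e ∈ koszulChains I i α := Submodule.sub_mem _ (koszulDiff_mem hbch) hc.1
  have hediff : koszulDiff I e = 0 := by
    rw [he, map_sub, koszulDiff_koszulDiff, LinearMap.mem_ker.1 hc.2, sub_zero]
  have hej : ∀ F, j ∉ F → e F = 0 := by
    intro F hF
    rw [he, Pi.sub_apply, koszulDiff_apply, sub_eq_zero,
      Finset.sum_eq_single_of_mem j (Finset.mem_compl.2 hF)]
    · have := hbc (insert j F) (Finset.mem_insert_self j F)
      rwa [Finset.erase_insert hF] at this
    · intro k _ hkj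
      rw [hb0, mul_zero, smul_zero]
      simp [hF, hkj.symm]
  ext F
  by_cases hjF : j ∈ F
  · obtain ⟨G, hjG, rfl⟩ : ∃ G, j ∉ G ∧ F = insert j G :=
      ⟨F.erase j, Finset.notMem_erase _ _, (Finset.insert_erase hjF).symm⟩
    have h1 := congrFun hediff G
    rw [koszulDiff_apply, Finset.sum_eq_single_of_mem j (Finset.mem_compl.2 hjG), Pi.zero_apply,
      smul_eq_zero_iff_right (pow_ne_zero _ (neg_ne_zero.2 one_ne_zero))] at h1
    · by_cases hF : (insert j G).card = i ∧ zeroOne (insert j G) ≤ α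
      · obtain ⟨r, hr⟩ := mem_quotComponent.1 ((mem_koszulChains.1 hech _).1 hF)
        rw [← hr, mk_X_mul, smul_eq_zero] at h1
        rw [← hr, Pi.zero_apply]
        rcases h1 with h1 | h1
        · rw [h1, zero_smul]
        · rw [hI.mk_monomial_eq_zero, add_comm] at h1
          rw [(hI.mk_monomial_eq_zero _).2 (hN j _ _ h1), smul_zero]
          rw [Finsupp.tsub_apply, zeroOne_apply]
          split_ifs
          omega
      · exact (mem_koszulChains.1 hech _).2 hF
    · intro k _ hkj
      rw [hej, mul_zero, smul_zero]
      simp [hjG, hkj.symm]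
  · exact hej F hjF

theorem IsMonomialOn.finite_betti (hI : IsMonomialOn I U) :
    {p : ℕ × (Fin n →₀ ℕ) | betti I p.1 p.2 ≠ 0}.Finite := by
  obtain ⟨N, hN⟩ := exists_stable_bound hI.isUpperSet
  refine ((Set.finite_Iic n).prod (Set.finite_Iic
    (Finsupp.equivFunOnFinite.symm fun _ : Fin n => N))).subset ?_
  rintro ⟨i, α⟩ h
  refine ⟨?_, ?_⟩
  · by_contra hi
    exact h (betti_eq_zero_of_lt (not_le.1 hi) α)
  · intro j
    by_contra hj
    exact h (hI.betti_eq_zero_of_large hN i (j := j) (not_le.1 hj))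

end Koszul

/-! ### Initial ideals of the ideal of the rational normal curve -/

section Toric

variable {K : Type*} [Field K] {d : ℕ}

/-- The exponent of `y` in the image of the monomial `t ^ m`. -/
def yDegree (d : ℕ) : (Fin (d + 1) →₀ ℕ) →+ ℕ :=
  Finsupp.weight fun i : Fin (d + 1) => (i : ℕ)

/-- The exponent of the image of `t ^ m` under `t_i ↦ x ^ (d - i) y ^ i`. -/
def curveExponent (d : ℕ) : (Fin (d + 1) →₀ ℕ) →+ (Fin 2 →₀ ℕ) :=
  Finsupp.weight fun i : Fin (d + 1) =>
    Finsupp.single (0 : Fin 2) (d - (i : ℕ)) + Finsupp.single (1 : Fin 2) (i : ℕ)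

theorem yDegree_single (i : Fin (d + 1)) (c : ℕ) :
    yDegree d (Finsupp.single i c) = c * (i : ℕ) := by
  rw [yDegree, Finsupp.weight_single, smul_eq_mul]

theorem yDegree_le (m : Fin (d + 1) →₀ ℕ) : yDegree d m ≤ m.degree * d := by
  rw [yDegree, Finsupp.weight_eq_sum, Finsupp.degree_eq_sum, Finset.sum_mul]
  exact Finset.sum_le_sum fun i _ => Nat.mul_le_mul_left _ (Nat.lt_succ_iff.1 i.2)

theorem curveExponent_one (m : Fin (d + 1) →₀ ℕ) : curveExponent d m 1 = yDegree d m := by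
  rw [curveExponent, yDegree, Finsupp.weight_eq_sum, Finsupp.weight_eq_sum,
    Finsupp.finsetSum_apply]
  simp

theorem curveExponent_zero_add (m : Fin (d + 1) →₀ ℕ) :
    curveExponent d m 0 + yDegree d m = m.degree * d := by
  rw [curveExponent, yDegree, Finsupp.weight_eq_sum, Finsupp.weight_eq_sum,
    Finsupp.finsetSum_apply, Finsupp.degree_eq_sum, Finset.sum_mul, ← Finset.sum_add_distrib]
  refine Finset.sum_congr rfl fun i _ => ?_
  have := i.2
  simp only [Finsupp.smul_apply, Finsupp.add_apply, smul_eq_mul]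
  rw [← mul_add]
  congr 1
  simp
  omega

theorem curveExponent_eq_iff (hd : 0 < d) (m m' : Fin (d + 1) →₀ ℕ) :
    curveExponent d m = curveExponent d m' ↔
      m.degree = m'.degree ∧ yDegree d m = yDegree d m' := by
  have h := curveExponent_zero_add m
  have h' := curveExponent_zero_add m'
  constructor
  · intro heq
    have hy : yDegree d m = yDegree d m' := by
      rw [← curveExponent_one, ← curveExponent_one, heq]
    rw [heq, hy, h'] at h
    exact ⟨(Nat.eq_of_mul_eq_mul_right hd h).symm, hy⟩
  · rintro ⟨hdeg, hy⟩
    ext i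
    fin_cases i
    · simp only [Fin.zero_eta]
      rw [← hdeg, ← hy] at h'
      omega
    · simp only [Fin.mk_one]
      rw [curveExponent_one, curveExponent_one, hy]

theorem aeval_curve_monomial (m : Fin (d + 1) →₀ ℕ) (r : K) :
    aeval (fun i : Fin (d + 1) =>
      (X 0 ^ (d - (i : ℕ)) * X 1 ^ (i : ℕ) : MvPolynomial (Fin 2) K)) (monomial m r) =
      monomial (curveExponent d m) r := by
  have h : (monomial (curveExponent d m) r : MvPolynomial (Fin 2) K) =
      C r * monomial (curveExponent d m) 1 := by
    rw [C_mul_monomial, mul_one]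
  rw [aeval_monomial, h, curveExponent, Finsupp.weight_eq_sum, monomial_sum_one,
    Finsupp.prod_fintype _ _ fun i => pow_zero _]
  refine congrArg _ (Finset.prod_congr rfl fun i _ => ?_)
  rw [X_pow_eq_monomial, X_pow_eq_monomial, monomial_mul, monomial_pow, one_mul, one_pow]

theorem sub_mem_rationalNormalCurveIdeal {m m' : Fin (d + 1) →₀ ℕ} (hd : 0 < d)
    (hdeg : m.degree = m'.degree) (hy : yDegree d m = yDegree d m') :
    monomial m (1 : K) - monomial m' 1 ∈ rationalNormalCurveIdeal K d := by
  rw [rationalNormalCurveIdeal, RingHom.mem_ker, map_sub, aeval_curve_monomial,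
    aeval_curve_monomial, (curveExponent_eq_iff hd m m').2 ⟨hdeg, hy⟩, sub_self]

/-- The map sends each t^m to a single monomial, so a coefficient of the image of f is the sum of
the coefficients of f over one fibre. -/
theorem sum_fiber_eq_zero {f : MvPolynomial (Fin (d + 1)) K}
    (hf : f ∈ rationalNormalCurveIdeal K d) (e : Fin 2 →₀ ℕ) :
    ∑ m ∈ f.support, (if curveExponent d m = e then coeff m f else 0) = 0 := by
  classical
  rw [rationalNormalCurveIdeal, RingHom.mem_ker, f.as_sum, map_sum] at hf
  have := congrArg (coeff e) hf
  simpa only [aeval_curve_monomial, coeff_sum, coeff_monomial, coeff_zero] using this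

/-- The exponents which are not `τ`-minimal among those with the same image in `K[x, y]`. -/
def leadSet (d : ℕ) (τ : MonomialOrder.{0, 0} (Fin (d + 1))) : Set (Fin (d + 1) →₀ ℕ) :=
  {m | ∃ m' : Fin (d + 1) →₀ ℕ, m.degree = m'.degree ∧ yDegree d m = yDegree d m' ∧
    τ.toSyn m' < τ.toSyn m}

variable (τ : MonomialOrder.{0, 0} (Fin (d + 1)))

theorem isUpperSet_leadSet : IsUpperSet (leadSet d τ) := by
  rintro m n hmn ⟨m', hdeg, hy, hlt⟩
  obtain ⟨c, rfl⟩ := exists_add_of_le hmn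
  refine ⟨m' + c, by simp [hdeg], by simp [hy], ?_⟩
  rw [map_add, map_add]
  exact add_lt_add_left hlt _

theorem monomial_sub_monomial_ne_zero {m m' : Fin (d + 1) →₀ ℕ} (h : m ≠ m') :
    monomial m (1 : K) - monomial m' 1 ≠ 0 := by
  rw [sub_ne_zero]
  exact fun h' => h (monomial_left_injective one_ne_zero h')

/-- The leading monomial of f ∈ P cannot be alone in its fibre, since the coefficients there sum to
zero; so a τ-smaller monomial shares it. Conversely a pair in one fibre gives a binomial of P with
the larger monomial as leading term. -/
theorem isMonomialOn_initialIdeal (hd : 0 < d) :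
    IsMonomialOn (initialIdeal τ (rationalNormalCurveIdeal K d)) (leadSet d τ) := by
  classical
  have : {g | ∃ f ∈ rationalNormalCurveIdeal K d, f ≠ 0 ∧ g = monomial (τ.degree f) (1 : K)} =
      (fun e => monomial e (1 : K)) '' leadSet d τ := by
    ext g
    constructor
    · rintro ⟨f, hf, hf0, rfl⟩
      refine ⟨τ.degree f, ?_, rfl⟩
      have hsum := sum_fiber_eq_zero hf (curveExponent d (τ.degree f))
      have hmem : τ.degree f ∈ f.support := (τ.degree_mem_support_iff f).2 hf0
      rw [← Finset.add_sum_erase _ _ hmem, if_pos rfl] at hsum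
      have hne : ∑ m ∈ f.support.erase (τ.degree f),
          (if curveExponent d m = curveExponent d (τ.degree f) then coeff m f else 0) ≠ 0 := by
        intro h
        rw [h, add_zero] at hsum
        exact (mem_support_iff.1 hmem) hsum
      obtain ⟨m, hm, hm0⟩ := Finset.exists_ne_zero_of_sum_ne_zero hne
      rw [Finset.mem_erase] at hm
      have heq : curveExponent d m = curveExponent d (τ.degree f) := by
        by_contra h
        exact hm0 (if_neg h)
      rw [curveExponent_eq_iff hd] at heq
      exact ⟨m, heq.1.symm, heq.2.symm,
        lt_of_le_of_ne (τ.le_degree hm.2) fun h => hm.1 (τ.toSyn.injective h)⟩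
    · rintro ⟨m, ⟨m', hdeg, hy, hlt⟩, rfl⟩
      refine ⟨_, sub_mem_rationalNormalCurveIdeal hd hdeg hy,
        monomial_sub_monomial_ne_zero fun h => ?_, ?_⟩
      · rw [h] at hlt
        exact lt_irrefl _ hlt
      · rw [τ.degree_sub_of_lt, τ.degree_monomial, if_neg one_ne_zero]
        rwa [τ.degree_monomial, τ.degree_monomial, if_neg one_ne_zero, if_neg one_ne_zero]
  rw [initialIdeal, this]
  exact isMonomialOn_span_of_isUpperSet (isUpperSet_leadSet τ)

/-- Weights in the cone are minimal at standard monomials. -/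
theorem weight_le_of_mem_cone (hd : 0 < d) {a : Fin (d + 1) → ℚ≥0}
    (ha : a ∈ cone τ (rationalNormalCurveIdeal K d)) {m m' : Fin (d + 1) →₀ ℕ}
    (hm : m ∉ leadSet d τ) (hdeg : m.degree = m'.degree) (hy : yDegree d m = yDegree d m') :
    Finsupp.weight a m ≤ Finsupp.weight a m' := by
  classical
  -- If the standard monomial t^m outweighed t^m', the a-initial form of t^m - t^m' ∈ P would be
  -- t^m. Then t^m would lie in in_τ(in_a(P)) = I, against standardness.
  by_contra! hlt
  have hne : m ≠ m' := by
    rintro rfl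
    exact lt_irrefl _ hlt
  have hcoeff : ∀ e, coeff e (monomial m (1 : K) - monomial m' 1) =
      (if m = e then 1 else 0) - if m' = e then 1 else 0 := by
    intro e
    rw [coeff_sub, coeff_monomial, coeff_monomial]
  have hw : weightedTotalDegree a (monomial m (1 : K) - monomial m' 1) = Finsupp.weight a m := by
    refine le_antisymm (Finset.sup_le fun e he => ?_) (le_weightedTotalDegree a ?_)
    · rw [mem_support_iff, hcoeff] at he
      by_cases h : m = e
      · rw [h]
      · by_cases h' : m' = e
        · rw [← h']
          exact hlt.le
        · simp [h, h'] at he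
    · rw [mem_support_iff, hcoeff]
      simp [hne.symm]
  have hin : monomial m (1 : K) = initialForm a (monomial m (1 : K) - monomial m' 1) := by
    ext e
    rw [initialForm, hw, coeff_weightedHomogeneousComponent, hcoeff, coeff_monomial]
    by_cases h : m = e
    · subst h
      simp [hne.symm]
    · by_cases h' : m' = e
      · subst h'
        simp [h, hlt.ne]
      · simp [h, h']
  have hmem : monomial m (1 : K) ∈ weightInitialIdeal a (rationalNormalCurveIdeal K d) :=
    Ideal.subset_span ⟨_, sub_mem_rationalNormalCurveIdeal hd hdeg hy,
      monomial_sub_monomial_ne_zero hne, hin⟩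
  have hmem' : monomial m (1 : K) ∈
      initialIdeal τ (weightInitialIdeal a (rationalNormalCurveIdeal K d)) := by
    refine Ideal.subset_span ⟨_, hmem, ?_, ?_⟩
    · simp
    · rw [τ.degree_monomial, if_neg one_ne_zero]
  rw [show initialIdeal τ _ = _ from ha, (isMonomialOn_initialIdeal τ hd).monomial_mem] at hmem'
  exact hm hmem'

/-! ### Standard monomials: one in each degree and y-degree -/

theorem eq_of_notMem_leadSet {m m' : Fin (d + 1) →₀ ℕ} (hm : m ∉ leadSet d τ)
    (hm' : m' ∉ leadSet d τ) (hdeg : m.degree = m'.degree) (hy : yDegree d m = yDegree d m') :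
    m = m' := by
  rcases lt_trichotomy (τ.toSyn m) (τ.toSyn m') with h | h | h
  · exact absurd ⟨m, hdeg.symm, hy.symm, h⟩ hm'
  · exact τ.toSyn.injective h
  · exact absurd ⟨m', hdeg, hy, h⟩ hm

theorem exists_yDegree_eq (k j : ℕ) (hj : j ≤ k * d) :
    ∃ m : Fin (d + 1) →₀ ℕ, m.degree = k ∧ yDegree d m = j := by
  induction k generalizing j with
  | zero => exact ⟨0, by simp, by simp at hj; simp [hj]⟩
  | succ k ih =>
    -- Greedy choice: one variable absorbs as much y-degree as possible, leaving at most kd for the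
    -- other k.
    obtain ⟨m, hm, hmj⟩ := ih (j - min j d) (by rw [Nat.succ_mul] at hj; omega)
    refine ⟨m + Finsupp.single ⟨min j d, by omega⟩ 1, by simp [hm], ?_⟩
    rw [map_add, yDegree_single, hmj]
    simp only
    omega

theorem exists_notMem_leadSet (k j : ℕ) (hj : j ≤ k * d) :
    ∃ m ∉ leadSet d τ, m.degree = k ∧ yDegree d m = j := by
  have hwf : WellFounded fun m m' : Fin (d + 1) →₀ ℕ => τ.toSyn m < τ.toSyn m' :=
    InvImage.wf _ wellFounded_lt
  obtain ⟨m, hm, hmin⟩ := hwf.has_min {m | m.degree = k ∧ yDegree d m = j}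
    (exists_yDegree_eq k j hj)
  refine ⟨m, ?_, hm⟩
  rintro ⟨m', hdeg, hy, hlt⟩
  exact hmin m' ⟨hdeg ▸ hm.1, hy ▸ hm.2⟩ hlt

/-- The standard monomial `t ^ m` with `|m| = k` and image `x ^ (k d - j) y ^ j`. -/
def stdExponent (k j : ℕ) : Fin (d + 1) →₀ ℕ := by
  classical
  -- The default value for j > kd is never used: all later arguments keep j between 0 and kd.
  exact if h : j ≤ k * d then (exists_notMem_leadSet τ k j h).choose else 0

theorem stdExponent_spec {k j : ℕ} (h : j ≤ k * d) :
    stdExponent τ k j ∉ leadSet d τ ∧ (stdExponent τ k j).degree = k ∧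
      yDegree d (stdExponent τ k j) = j := by
  rw [stdExponent, dif_pos h]
  exact (exists_notMem_leadSet τ k j h).choose_spec

/-- The y-degree maps the standard monomials of degree k bijectively onto 0, …, kd. -/
theorem sum_stdIndicator (k : ℕ) (g : (Fin (d + 1) →₀ ℕ) → ℤ) :
    ∑ m ∈ exponents (d + 1) k, g m * stdIndicator (leadSet d τ) m =
      ∑ j ∈ Finset.range (k * d + 1), g (stdExponent τ k j) := by
  classical
  have : ∀ m, g m * stdIndicator (leadSet d τ) m = if m ∉ leadSet d τ then g m else 0 := by
    intro m
    by_cases hm : m ∈ leadSet d τ <;> simp [stdIndicator, hm]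
  simp only [this, ← Finset.sum_filter]
  symm
  refine Finset.sum_bij (fun j _ => stdExponent τ k j) ?_ ?_ ?_ ?_
  · intro j hj
    obtain ⟨h1, h2, -⟩ := stdExponent_spec τ (Nat.lt_succ_iff.1 (Finset.mem_range.1 hj))
    exact Finset.mem_filter.2 ⟨mem_exponents.2 h2, h1⟩
  · intro j hj j' hj' h
    rw [← (stdExponent_spec τ (Nat.lt_succ_iff.1 (Finset.mem_range.1 hj))).2.2, h,
      (stdExponent_spec τ (Nat.lt_succ_iff.1 (Finset.mem_range.1 hj'))).2.2]
  · intro m hm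
    rw [Finset.mem_filter, mem_exponents] at hm
    have hle : yDegree d m ≤ k * d := hm.1 ▸ yDegree_le m
    refine ⟨yDegree d m, Finset.mem_range.2 (Nat.lt_succ_iff.2 hle), ?_⟩
    obtain ⟨h1, h2, h3⟩ := stdExponent_spec τ hle
    exact eq_of_notMem_leadSet τ h1 hm.2 (h2.trans hm.1.symm) h3
  · intro j _
    rfl

/-- There are kd + 1 standard monomials of degree k, so the series is ∑ (kd + 1) z^k. -/
theorem genSeries_stdIndicator :
    (1 - PowerSeries.X) ^ 2 * genSeries (stdIndicator (leadSet d τ)) =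
      1 + ((d : PowerSeries ℤ) - 1) * PowerSeries.X := by
  have h1 : genSeries (stdIndicator (leadSet d τ)) =
      PowerSeries.mk fun k => ((k * d + 1 : ℕ) : ℤ) := by
    ext k
    have := sum_stdIndicator τ k fun _ => 1
    rw [coeff_genSeries, PowerSeries.coeff_mk]
    simpa using this
  have h2 : (1 - PowerSeries.X) * genSeries (stdIndicator (leadSet d τ)) =
      1 + (d : PowerSeries ℤ) * PowerSeries.X * PowerSeries.mk 1 := by
    rw [h1]
    ext k
    rw [sub_mul, one_mul, mul_comm (d : PowerSeries ℤ), mul_assoc]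
    cases k with
    | zero => simp
    | succ k =>
      rw [map_sub, map_add, PowerSeries.coeff_succ_X_mul, PowerSeries.coeff_succ_X_mul,
        ← map_natCast (PowerSeries.C (R := ℤ)), PowerSeries.coeff_C_mul]
      simp [PowerSeries.coeff_one]
      ring
  have h3 := PowerSeries.mk_one_mul_one_sub_eq_one ℤ
  linear_combination (1 - PowerSeries.X) * h2 + (d : PowerSeries ℤ) * PowerSeries.X * h3

/-- Three free directions i < j < l would place two monomials of one fibre in the cone,
contradicting uniqueness of the standard monomial. This bounds the pole order of each cone by 2. -/
theorem card_le_two_of_coneSet_subset {ω : (Fin (d + 1) →₀ ℕ) × Finset (Fin (d + 1))}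
    (hω : coneSet ω ⊆ (leadSet d τ)ᶜ) : ω.2.card ≤ 2 := by
  by_contra! hcard
  obtain ⟨σ, S⟩ := ω
  simp only at hcard
  set f := Finset.orderEmbOfCardLe S (k := 3) hcard with hf
  have hmem : ∀ a, f a ∈ S := Finset.orderEmbOfCardLe_mem S hcard
  obtain ⟨i, hi⟩ : ∃ i, i = f 0 := ⟨_, rfl⟩
  obtain ⟨j, hj⟩ : ∃ j, j = f 1 := ⟨_, rfl⟩
  obtain ⟨l, hl⟩ : ∃ l, l = f 2 := ⟨_, rfl⟩
  have hij : i < j := by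
    rw [hi, hj]
    exact f.strictMono (by decide)
  have hjl : j < l := by
    rw [hj, hl]
    exact f.strictMono (by decide)
  have hiS : i ∈ S := hi ▸ hmem 0
  have hjS : j ∈ S := hj ▸ hmem 1
  have hlS : l ∈ S := hl ▸ hmem 2
  have hij' : (i : ℕ) < j := hij
  have hjl' : (j : ℕ) < l := hjl
  -- The relation is t_j^(l-i) ~ t_i^(l-j) t_l^(j-i): both have degree l - i, and j(l-i) = i(l-j) +
  -- l(j-i).
  have h1 : σ + Finsupp.single j ((l : ℕ) - i) ∈ coneSet (σ, S) := by
    rw [mem_coneSet_iff]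
    intro k
    refine ⟨by simp, fun hk => ?_⟩
    have : j ≠ k := fun h => hk (h ▸ hjS)
    simp [this]
  have h2 : σ + (Finsupp.single i ((l : ℕ) - j) + Finsupp.single l ((j : ℕ) - i)) ∈
      coneSet (σ, S) := by
    rw [mem_coneSet_iff]
    intro k
    refine ⟨by simp, fun hk => ?_⟩
    have h : i ≠ k := fun h => hk (h ▸ hiS)
    have h' : l ≠ k := fun h => hk (h ▸ hlS)
    simp [h, h']
  have heq := eq_of_notMem_leadSet τ (hω h1) (hω h2)
    (by simp only [map_add, Finsupp.degree_single]; omega)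
    (by
      simp only [map_add, yDegree_single]
      zify [hij'.le, hjl'.le, (hij'.trans hjl').le]
      ring)
  have := DFunLike.congr_fun heq j
  simp [hij.ne, hjl.ne'] at this
  omega

end Toric

/-! ### Hilbert functions of monomial ideals of `K[x, y]` -/

section Hilbert

variable {K : Type*} [Field K] {d : ℕ} {L : Ideal (MvPolynomial (Fin 2) K)}
  {V : Set (Fin 2 →₀ ℕ)}

/-- The exponent of `x ^ p y ^ q`. -/
def xyExponent (p q : ℕ) : Fin 2 →₀ ℕ :=
  Finsupp.single 0 p + Finsupp.single 1 q

@[simp]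
theorem xyExponent_zero (p q : ℕ) : xyExponent p q 0 = p := by
  simp [xyExponent]

@[simp]
theorem xyExponent_one (p q : ℕ) : xyExponent p q 1 = q := by
  simp [xyExponent]

theorem le_xy_iff (m m' : Fin 2 →₀ ℕ) : m ≤ m' ↔ m 0 ≤ m' 0 ∧ m 1 ≤ m' 1 := by
  rw [Finsupp.le_def, Fin.forall_fin_two]

theorem eq_xyExponent (m : Fin 2 →₀ ℕ) : m = xyExponent (m 0) (m 1) :=
  le_antisymm ((le_xy_iff _ _).2 (by simp)) ((le_xy_iff _ _).2 (by simp))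

theorem X_pow_mul_X_pow (p q : ℕ) :
    (X 0 ^ p * X 1 ^ q : MvPolynomial (Fin 2) K) = monomial (xyExponent p q) 1 := by
  rw [X_pow_eq_monomial, X_pow_eq_monomial, monomial_mul, one_mul, xyExponent]

theorem IsMonomialOn.assocSeq_eq (hL : IsMonomialOn L V) (i : Fin (d + 1)) :
    assocSeq d L i = sInf {j | xyExponent (d - (i : ℕ)) j ∈ V} := by
  simp only [assocSeq, X_pow_mul_X_pow, hL.monomial_mem]

theorem IsMonomialOn.assocSeq_le (hL : IsMonomialOn L V) {i : Fin (d + 1)} {j : ℕ}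
    (h : xyExponent (d - (i : ℕ)) j ∈ V) : assocSeq d L i ≤ j := by
  rw [hL.assocSeq_eq]
  exact Nat.sInf_le h

theorem IsMonomialOn.assocSeq_mem (hL : IsMonomialOn L V)
    (hrad : L.radical = idealOfVars (Fin 2) K) (i : Fin (d + 1)) :
    xyExponent (d - (i : ℕ)) (assocSeq d L i) ∈ V := by
  rw [hL.assocSeq_eq]
  refine Nat.sInf_mem (s := {j | xyExponent (d - (i : ℕ)) j ∈ V}) ?_
  have hX : (X 1 : MvPolynomial (Fin 2) K) ∈ L.radical := by
    rw [hrad]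
    exact Ideal.subset_span ⟨1, rfl⟩
  obtain ⟨k, hk⟩ := hX
  refine ⟨k, ?_⟩
  rw [Set.mem_ofPred_eq, ← hL.monomial_mem, ← X_pow_mul_X_pow]
  exact L.mul_mem_left _ hk

theorem IsMonomialOn.assocSeq_mono (hL : IsMonomialOn L V)
    (hrad : L.radical = idealOfVars (Fin 2) K) {i j : Fin (d + 1)} (hij : i ≤ j) :
    assocSeq d L i ≤ assocSeq d L j := by
  refine hL.assocSeq_le (hL.isUpperSet ?_ (hL.assocSeq_mem hrad j))
  have : (i : ℕ) ≤ j := hij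
  rw [le_xy_iff]
  simp
  omega

theorem IsMonomialOn.assocSeq_zero (hL : IsMonomialOn L V)
    (hx : (X 0 : MvPolynomial (Fin 2) K) ^ d ∈ L) : assocSeq d L 0 = 0 := by
  refine Nat.le_zero.1 (hL.assocSeq_le ?_)
  rw [← hL.monomial_mem, ← X_pow_mul_X_pow]
  simpa using hx

/-- Since x^d ∈ L, the monomials x^(d-i) y^(a_i) generate L; columns with x-exponent at least d are
covered by i = 0, where a_0 = 0. -/
theorem IsMonomialOn.mem_iff_assocSeq (hL : IsMonomialOn L V)
    (hrad : L.radical = idealOfVars (Fin 2) K) (hx : (X 0 : MvPolynomial (Fin 2) K) ^ d ∈ L)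
    (m : Fin 2 →₀ ℕ) :
    m ∈ V ↔ ∃ i : Fin (d + 1), d ≤ m 0 + (i : ℕ) ∧ assocSeq d L i ≤ m 1 := by
  constructor
  · intro hm
    by_cases hd : d ≤ m 0
    · exact ⟨0, by simpa using hd, by simp [hL.assocSeq_zero hx]⟩
    · refine ⟨⟨d - m 0, by omega⟩, by simp only; omega, hL.assocSeq_le ?_⟩
      simp only
      rwa [show d - (d - m 0) = m 0 by omega, ← eq_xyExponent]
  · rintro ⟨i, h1, h2⟩
    refine hL.isUpperSet ?_ (hL.assocSeq_mem hrad i)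
    rw [le_xy_iff]
    simp
    omega

/-- The exponents of the monomials of `L ^ k`, where `L` has associated sequence `a`. -/
def powerSet (a : Fin (d + 1) → ℕ) (k : ℕ) : Set (Fin 2 →₀ ℕ) :=
  {m | ∃ n : Fin (d + 1) →₀ ℕ, n.degree = k ∧ k * d ≤ m 0 + yDegree d n ∧
    Finsupp.weight a n ≤ m 1}

theorem exists_eq_add_single {n : Fin (d + 1) →₀ ℕ} {i : Fin (d + 1)} (hi : n i ≠ 0) :
    ∃ n', n = n' + Finsupp.single i 1 :=
  ⟨n - Finsupp.single i 1, (tsub_add_cancel_of_le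
    (Finsupp.single_le_iff.2 (Nat.one_le_iff_ne_zero.2 hi))).symm⟩

/-- L^k is generated by products of k generators x^(d-i) y^(a_i); the exponent n in `powerSet`
records how often each is used. -/
theorem IsMonomialOn.pow (hL : IsMonomialOn L V)
    (hrad : L.radical = idealOfVars (Fin 2) K) (hx : (X 0 : MvPolynomial (Fin 2) K) ^ d ∈ L)
    (k : ℕ) : IsMonomialOn (L ^ k) (powerSet (assocSeq d L) k) := by
  induction k with
  | zero =>
    intro f
    rw [pow_zero, Ideal.one_eq_top]
    refine ⟨fun _ m _ => ⟨0, by simp⟩, fun _ => trivial⟩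
  | succ k ih =>
    rw [pow_succ]
    convert ih.mul hL
    ext m
    constructor
    · rintro ⟨n, hn, h1, h2⟩
      have hn0 : n ≠ 0 := by
        rintro rfl
        simp at hn
      obtain ⟨i, hi⟩ := Finsupp.ne_iff.1 hn0
      obtain ⟨n, rfl⟩ := exists_eq_add_single hi
      rw [map_add, Finsupp.degree_single, Nat.succ_inj] at hn
      rw [map_add, yDegree_single, Nat.succ_mul] at h1
      rw [map_add, Finsupp.weight_single] at h2
      simp only [smul_eq_mul, one_mul] at h1 h2
      have hle := yDegree_le n
      rw [hn] at hle
      have hid := i.2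
      refine ⟨xyExponent (m 0 - (d - i)) (m 1 - assocSeq d L i), ⟨n, hn, ?_, ?_⟩,
        xyExponent (d - i) (assocSeq d L i), hL.assocSeq_mem hrad i, ?_⟩
      · rw [xyExponent_zero]
        omega
      · rw [xyExponent_one]
        omega
      · rw [eq_xyExponent (_ + _)]
        conv_rhs => rw [eq_xyExponent m]
        simp only [Finsupp.add_apply, xyExponent_zero, xyExponent_one]
        congr 1 <;> omega
    · rintro ⟨u, ⟨n, hn, h1, h2⟩, v, hv, rfl⟩
      obtain ⟨i, h3, h4⟩ := (hL.mem_iff_assocSeq hrad hx v).1 hv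
      refine ⟨n + Finsupp.single i 1, by simp [hn], ?_, ?_⟩
      · rw [map_add, yDegree_single, Finsupp.add_apply, Nat.succ_mul]
        omega
      · rw [map_add, Finsupp.weight_single, Finsupp.add_apply, one_smul]
        omega

/-! ### Counting the monomials outside a power of L -/

variable {τ : MonomialOrder.{0, 0} (Fin (d + 1))} {a : Fin (d + 1) → ℕ}

/-- The weight `a` is minimal at the standard monomials. -/
def IsMinimalWeight (τ : MonomialOrder.{0, 0} (Fin (d + 1))) (a : Fin (d + 1) → ℕ) : Prop :=
  ∀ m ∉ leadSet d τ, ∀ m' : Fin (d + 1) →₀ ℕ, m.degree = m'.degree →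
    yDegree d m = yDegree d m' → Finsupp.weight a m ≤ Finsupp.weight a m'

theorem isMinimalWeight_of_mem_cone (hd : 0 < d)
    (ha : (fun i => (a i : ℚ≥0)) ∈ cone τ (rationalNormalCurveIdeal K d)) :
    IsMinimalWeight τ a := by
  intro m hm m' hdeg hy
  have hcast : ∀ m : Fin (d + 1) →₀ ℕ,
      Finsupp.weight (fun i => (a i : ℚ≥0)) m = (Finsupp.weight a m : ℚ≥0) := by
    intro m
    simp [Finsupp.weight_eq_sum]
  have := weight_le_of_mem_cone τ hd ha hm hdeg hy
  rw [hcast, hcast] at this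
  exact_mod_cast this

/-- The minimal weight of an exponent of degree `k` and `y`-degree `j`. -/
def minWeight (τ : MonomialOrder.{0, 0} (Fin (d + 1))) (a : Fin (d + 1) → ℕ) (k j : ℕ) : ℕ :=
  Finsupp.weight a (stdExponent τ k j)

theorem IsMinimalWeight.minWeight_le (hmin : IsMinimalWeight τ a) (m : Fin (d + 1) →₀ ℕ) :
    minWeight τ a m.degree (yDegree d m) ≤ Finsupp.weight a m := by
  obtain ⟨h1, h2, h3⟩ := stdExponent_spec τ (yDegree_le m)
  exact hmin _ h1 m h2 h3

/-- Replacing one factor t_i, i > 0, of the optimal monomial by t_{i-1} lowers the y-degree by one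
and, a being monotone, does not raise the weight. -/
theorem IsMinimalWeight.minWeight_le_succ (hmin : IsMinimalWeight τ a) (hmono : Monotone a)
    {k j : ℕ} (hj : j + 1 ≤ k * d) : minWeight τ a k j ≤ minWeight τ a k (j + 1) := by
  obtain ⟨-, h2, h3⟩ := stdExponent_spec τ hj
  rw [minWeight, minWeight]
  set n := stdExponent τ k (j + 1)
  obtain ⟨i, hi, hi0⟩ : ∃ i : Fin (d + 1), n i ≠ 0 ∧ (i : ℕ) ≠ 0 := by
    by_contra! h
    rw [yDegree, Finsupp.weight_eq_sum, Finset.sum_eq_zero] at h3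
    · omega
    · intro i _
      by_cases hi : n i = 0
      · simp [hi]
      · simp [h i hi]
  obtain ⟨n', hn'⟩ := exists_eq_add_single hi
  rw [hn', map_add, yDegree_single] at h3
  rw [hn', map_add, Finsupp.degree_single] at h2
  have hlt : (i : ℕ) - 1 < d + 1 := by omega
  have h := hmin.minWeight_le (n' + Finsupp.single ⟨(i : ℕ) - 1, hlt⟩ 1)
  rw [map_add, Finsupp.degree_single, h2, map_add, yDegree_single, map_add,
    Finsupp.weight_single, one_smul, one_mul] at h
  rw [show yDegree d n' + ((i : ℕ) - 1) = j by omega] at h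
  rw [hn', map_add, Finsupp.weight_single, one_smul]
  refine h.trans (Nat.add_le_add_left (hmono ?_) _)
  exact Fin.le_def.2 (Nat.sub_le _ _)

theorem IsMinimalWeight.minWeight_mono (hmin : IsMinimalWeight τ a) (hmono : Monotone a)
    {k j j' : ℕ} (hjj : j ≤ j') (hj : j' ≤ k * d) : minWeight τ a k j ≤ minWeight τ a k j' := by
  induction j', hjj using Nat.le_induction with
  | base => exact le_rfl
  | succ j' _ ih => exact (ih (by omega)).trans (hmin.minWeight_le_succ hmono hj)

/-- Column p of the staircase has as height the least weight among y-degrees at least kd - p, which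
by monotonicity is attained at kd - p itself. Columns p ≥ kd are filled by x^(kd), of weight 0. -/
theorem IsMinimalWeight.mem_powerSet_iff (hmin : IsMinimalWeight τ a) (hmono : Monotone a)
    (h0 : a 0 = 0) (k : ℕ) (m : Fin 2 →₀ ℕ) :
    m ∉ powerSet a k ↔ m 0 < k * d ∧ m 1 < minWeight τ a k (k * d - m 0) := by
  rw [← not_iff_not, not_not, not_and_or, not_lt, not_lt]
  constructor
  · rintro ⟨n, hn, h1, h2⟩
    by_cases hm : k * d ≤ m 0
    · exact Or.inl hm
    · have hle := yDegree_le n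
      have h := hmin.minWeight_le n
      rw [hn] at hle h
      exact Or.inr ((hmin.minWeight_mono hmono (by omega) hle).trans (h.trans h2))
  · rintro (h | h)
    · exact ⟨Finsupp.single 0 k, by simp, by simpa [yDegree_single] using h,
        by simp [Finsupp.weight_single, h0]⟩
    · obtain ⟨-, h2, h3⟩ := stdExponent_spec τ (Nat.sub_le (k * d) (m 0))
      exact ⟨_, h2, by rw [h3]; omega, h⟩

theorem IsMinimalWeight.minWeight_zero (hmin : IsMinimalWeight τ a) (h0 : a 0 = 0) (k : ℕ) :
    minWeight τ a k 0 = 0 := by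
  have := hmin.minWeight_le (Finsupp.single 0 k)
  rw [Finsupp.degree_single, yDegree_single, Finsupp.weight_single, h0] at this
  simpa using this

/-- The exponents of the monomials outside of `L ^ k`. -/
def powerCompl (τ : MonomialOrder.{0, 0} (Fin (d + 1))) (a : Fin (d + 1) → ℕ) (k : ℕ) :
    Finset (Fin 2 →₀ ℕ) := by
  classical
  exact ((Finset.range (k * d)).sigma fun p => Finset.range (minWeight τ a k (k * d - p))).image
    fun p => xyExponent p.1 p.2

theorem IsMinimalWeight.mem_powerCompl (hmin : IsMinimalWeight τ a) (hmono : Monotone a)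
    (h0 : a 0 = 0) (k : ℕ) (m : Fin 2 →₀ ℕ) : m ∈ powerCompl τ a k ↔ m ∉ powerSet a k := by
  rw [hmin.mem_powerSet_iff hmono h0, powerCompl, Finset.mem_image]
  constructor
  · rintro ⟨⟨p, q⟩, h, rfl⟩
    simpa using h
  · intro h
    exact ⟨⟨m 0, m 1⟩, by simpa using h, (eq_xyExponent m).symm⟩

theorem IsMinimalWeight.card_powerCompl (hmin : IsMinimalWeight τ a) (h0 : a 0 = 0) (k : ℕ) :
    (powerCompl τ a k).card = ∑ j ∈ Finset.range (k * d + 1), minWeight τ a k j := by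
  -- The columns p = 0, …, kd - 1 correspond to j = kd - p = kd, …, 1; the missing term j = 0 has
  -- weight zero.
  rw [powerCompl, Finset.card_image_of_injective, Finset.card_sigma, Finset.sum_range_succ',
    hmin.minWeight_zero h0, add_zero, ← Finset.sum_range_reflect]
  · refine Finset.sum_congr rfl fun p hp => ?_
    rw [Finset.mem_range] at hp
    rw [Finset.card_range]
    congr 1
    omega
  · rintro ⟨p, q⟩ ⟨p', q'⟩ h
    have h1 := DFunLike.congr_fun h 0
    have h2 := DFunLike.congr_fun h 1
    simp only [xyExponent_zero, xyExponent_one] at h1 h2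
    rw [h1, h2]

theorem finite_quotient_pow (hL : IsMonomialOn L V)
    (hrad : L.radical = idealOfVars (Fin 2) K) (hx : (X 0 : MvPolynomial (Fin 2) K) ^ d ∈ L)
    (hmin : IsMinimalWeight τ (assocSeq d L)) (k : ℕ) :
    Module.Finite K (MvPolynomial (Fin 2) K ⧸ L ^ k) :=
  (hL.pow hrad hx k).finite_quotient (powerCompl τ (assocSeq d L) k)
    (hmin.mem_powerCompl (fun _ _ => hL.assocSeq_mono hrad) (hL.assocSeq_zero hx) k)

/-- The central count: column heights are weights of standard monomials, so the dimension is linear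
in the associated sequence, with coefficients depending only on the initial ideal. -/
theorem finrank_quotient_pow (hL : IsMonomialOn L V)
    (hrad : L.radical = idealOfVars (Fin 2) K) (hx : (X 0 : MvPolynomial (Fin 2) K) ^ d ∈ L)
    (hmin : IsMinimalWeight τ (assocSeq d L)) (k : ℕ) :
    (Module.finrank K (MvPolynomial (Fin 2) K ⧸ L ^ k) : ℤ) =
      ∑ m ∈ exponents (d + 1) k,
        (Finsupp.weight (assocSeq d L) m : ℤ) * stdIndicator (leadSet d τ) m := by
  rw [(hL.pow hrad hx k).finrank_quotient (powerCompl τ (assocSeq d L) k)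
    (hmin.mem_powerCompl (fun _ _ => hL.assocSeq_mono hrad) (hL.assocSeq_zero hx) k),
    hmin.card_powerCompl (hL.assocSeq_zero hx)]
  have := sum_stdIndicator τ k fun m => (Finsupp.weight (assocSeq d L) m : ℤ)
  rw [this]
  simp [minWeight]

/-- The factor z accounts for H¹(L, k) involving L^(k+1). The constant term on the right vanishes
because the only monomial of degree 0 has weight 0. -/
theorem X_mul_mk_hilbertFun₁ (hL : IsMonomialOn L V)
    (hrad : L.radical = idealOfVars (Fin 2) K) (hx : (X 0 : MvPolynomial (Fin 2) K) ^ d ∈ L)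
    (hmin : IsMinimalWeight τ (assocSeq d L)) :
    PowerSeries.X * PowerSeries.mk (fun k => (hilbertFun₁ L k : ℤ)) =
      ∑ j, (assocSeq d L j : PowerSeries ℤ) * momentSeries j (stdIndicator (leadSet d τ)) := by
  have h : ∑ j, (assocSeq d L j : PowerSeries ℤ) * momentSeries j (stdIndicator (leadSet d τ)) =
      genSeries fun m => (Finsupp.weight (assocSeq d L) m : ℤ) *
        stdIndicator (leadSet d τ) m := by
    ext k
    rw [map_sum, coeff_genSeries]
    simp only [momentSeries_apply, ← map_natCast (PowerSeries.C (R := ℤ)),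
      PowerSeries.coeff_C_mul, coeff_genSeries, Finset.mul_sum]
    rw [Finset.sum_comm]
    refine Finset.sum_congr rfl fun m _ => ?_
    rw [Finsupp.weight_eq_sum, Nat.cast_sum, Finset.sum_mul]
    refine Finset.sum_congr rfl fun j _ => ?_
    rw [smul_eq_mul]
    push_cast
    ring
  rw [h]
  ext k
  rw [coeff_genSeries, ← finrank_quotient_pow hL hrad hx hmin]
  cases k with
  | zero =>
    rw [PowerSeries.coeff_zero_X_mul, finrank_quotient_pow hL hrad hx hmin]
    symm
    refine Finset.sum_eq_zero fun m hm => ?_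
    rw [mem_exponents, Finsupp.degree_eq_zero_iff] at hm
    simp [hm]
  | succ k =>
    rw [PowerSeries.coeff_succ_X_mul, PowerSeries.coeff_mk]
    rfl

/-- The subquotient `N / M` is the kernel of the surjection `R / M → R / N`. -/
theorem finrank_subquotient {R : Type*} [CommRing R] [Algebra K R] {M N : Ideal R} (h : M ≤ N)
    [Module.Finite K (R ⧸ M)] :
    Module.finrank K (N ⧸ M.submoduleOf N) + Module.finrank K (R ⧸ N) =
      Module.finrank K (R ⧸ M) := by
  let f : (N ⧸ M.submoduleOf N) →ₗ[R] R ⧸ M := Submodule.mapQ _ _ N.subtype le_rfl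
  let g : (R ⧸ M) →ₗ[R] R ⧸ N := Submodule.mapQ _ _ LinearMap.id h
  have hf : LinearMap.ker f = ⊥ :=
    (Submodule.ker_mapQ _ _ _ le_rfl).trans (Submodule.mkQ_map_self _)
  have hg : LinearMap.range g = ⊤ := by
    rw [Submodule.range_mapQ, LinearMap.range_id, Submodule.map_top, Submodule.range_mkQ]
  have hfg : LinearMap.range f = LinearMap.ker g := by
    refine (Submodule.range_mapQ _ _ _ le_rfl).trans ?_
    rw [Submodule.ker_mapQ, Submodule.range_subtype, Submodule.comap_id]
  have h1 := LinearMap.finrank_range_add_finrank_ker (g.restrictScalars K)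
  have h2 : Module.finrank K (LinearMap.range (g.restrictScalars K)) =
      Module.finrank K (R ⧸ N) := by
    rw [LinearMap.range_restrictScalars, hg]
    exact finrank_top K (R ⧸ N)
  have h3 : Module.finrank K (LinearMap.ker (g.restrictScalars K)) =
      Module.finrank K (N ⧸ M.submoduleOf N) := by
    rw [LinearMap.ker_restrictScalars, ← hfg]
    exact ((LinearEquiv.ofInjective f (LinearMap.ker_eq_bot.1 hf)).restrictScalars K).finrank_eq.symm
  omega

theorem hilbertFun_succ (hL : IsMonomialOn L V)
    (hrad : L.radical = idealOfVars (Fin 2) K) (hx : (X 0 : MvPolynomial (Fin 2) K) ^ d ∈ L)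
    (hmin : IsMinimalWeight τ (assocSeq d L)) (k : ℕ) :
    hilbertFun L (k + 1) + hilbertFun₁ L k = hilbertFun₁ L (k + 1) := by
  have := finite_quotient_pow hL hrad hx hmin (k + 1 + 1)
  exact finrank_subquotient (Ideal.pow_le_pow_right (Nat.le_succ _))

/-- The coefficients of `p(z) / (1 - z) ^ (r + 1)` are eventually polynomial. -/
theorem coeff_eq_of_one_sub_pow_mul {p : Polynomial ℤ} {r : ℕ} {H : PowerSeries ℤ}
    (h : (p : PowerSeries ℤ) = (1 - PowerSeries.X) ^ (r + 1) * H) {k : ℕ}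
    (hk : p.natDegree ≤ k) :
    PowerSeries.coeff k H = p.sum fun i c => c * ((r + (k - i)).choose r : ℕ) := by
  have hH : H = (p : PowerSeries ℤ) * PowerSeries.mk fun n => ((r + n).choose r : ℤ) := by
    have h1 := PowerSeries.mk_add_choose_mul_one_sub_pow_eq_one ℤ r
    rw [h]
    linear_combination -H * h1
  rw [hH]
  conv_lhs => rw [p.as_sum_support_C_mul_X_pow]
  have : ((∑ i ∈ p.support, Polynomial.C (p.coeff i) * Polynomial.X ^ i : Polynomial ℤ) :
      PowerSeries ℤ) = ∑ i ∈ p.support, PowerSeries.C (p.coeff i) * PowerSeries.X ^ i := by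
    rw [← Polynomial.coeToPowerSeries.ringHom_apply, map_sum]
    refine Finset.sum_congr rfl fun i _ => ?_
    rw [Polynomial.coeToPowerSeries.ringHom_apply, Polynomial.coe_mul, Polynomial.coe_C,
      Polynomial.coe_pow, Polynomial.coe_X]
  rw [this, Finset.sum_mul, map_sum, Polynomial.sum]
  refine Finset.sum_congr rfl fun i hi => ?_
  have hik : i ≤ k := (Polynomial.le_natDegree_of_mem_supp i hi).trans hk
  rw [mul_assoc, PowerSeries.coeff_C_mul, PowerSeries.coeff_X_pow_mul', if_pos hik,
    PowerSeries.coeff_mk]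

theorem isHilbertPolynomial_of_cube {p : Polynomial ℤ} {H : ℕ → ℕ}
    (h : (p : PowerSeries ℤ) =
      (1 - PowerSeries.X) ^ 3 * PowerSeries.mk (fun k => (H k : ℤ))) :
    IsHilbertPolynomial H (p.sum fun i c => Polynomial.C ((c : ℚ) / 2) *
      ((Polynomial.X - (i : Polynomial ℚ) + 2) * (Polynomial.X - (i : Polynomial ℚ) + 1))) := by
  refine Filter.eventually_atTop.2 ⟨p.natDegree, fun k hk => ?_⟩
  have h1 := coeff_eq_of_one_sub_pow_mul (r := 2) h hk
  rw [PowerSeries.coeff_mk] at h1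
  have h2 : (H k : ℚ) = ((H k : ℤ) : ℚ) := by simp
  rw [h2, h1, Polynomial.sum, Polynomial.sum, Polynomial.eval_finsetSum, Int.cast_sum]
  refine Finset.sum_congr rfl fun i hi => ?_
  have hik : i ≤ k := (Polynomial.le_natDegree_of_mem_supp i hi).trans hk
  -- Since k is at least the degree of p, the truncated difference k - i is genuine and the binomial
  -- coefficient is a polynomial in k.
  rw [Int.cast_mul, Int.cast_natCast, Nat.cast_choose_two]
  simp [Nat.cast_sub hik]
  ring

theorem isHilbertPolynomial_of_square {p : Polynomial ℤ} {H : ℕ → ℕ} {G : PowerSeries ℤ}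
    (h : (p : PowerSeries ℤ) = (1 - PowerSeries.X) ^ 2 * G)
    (hG : ∀ᶠ k in Filter.atTop, (H k : ℤ) = PowerSeries.coeff k G) :
    IsHilbertPolynomial H (p.sum fun i c => Polynomial.C (c : ℚ) *
      (Polynomial.X - (i : Polynomial ℚ) + 1)) := by
  filter_upwards [hG, Filter.eventually_ge_atTop p.natDegree] with k hGk hk
  have h1 := coeff_eq_of_one_sub_pow_mul (r := 1) h hk
  have h2 : (H k : ℚ) = ((H k : ℤ) : ℚ) := by simp
  rw [h2, hGk, h1, Polynomial.sum, Polynomial.sum, Polynomial.eval_finsetSum, Int.cast_sum]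
  refine Finset.sum_congr rfl fun i hi => ?_
  have hik : i ≤ k := (Polynomial.le_natDegree_of_mem_supp i hi).trans hk
  rw [Int.cast_mul, Int.cast_natCast, Nat.choose_one_right, Nat.cast_add, Nat.cast_sub hik]
  simp only [Polynomial.eval_mul, Polynomial.eval_add, Polynomial.eval_sub, Polynomial.eval_C,
    Polynomial.eval_X, Polynomial.eval_natCast, Polynomial.eval_one]
  ring

end Hilbert

/-! ### Linear forms -/

section LinearForms

variable {n : ℕ}

theorem isHomogeneous_linForm {R : Type*} [CommSemiring R] (v : Fin n → R) :
    (linForm v).IsHomogeneous 1 :=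
  IsHomogeneous.sum _ _ _ fun j _ => isHomogeneous_C_mul_X (v j) j

theorem coeff_linForm {R : Type*} [CommSemiring R] (v : Fin n → R) (j : Fin n) :
    (linForm v).coeff (Finsupp.single j 1) = v j := by
  classical
  rw [linForm, coeff_sum]
  simp [coeff_C_mul, coeff_X, Finsupp.single_left_inj]

theorem linForm_add {R : Type*} [CommSemiring R] (v w : Fin n → R) :
    linForm v + linForm w = linForm (v + w) := by
  simp [linForm, add_mul, Finset.sum_add_distrib]

theorem sum_linForm {R : Type*} [CommSemiring R] {ι : Type*} (s : Finset ι) (v : ι → Fin n → R) :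
    ∑ i ∈ s, linForm (v i) = linForm fun j => ∑ i ∈ s, v i j := by
  simp only [linForm, map_sum, Finset.sum_mul]
  exact Finset.sum_comm

theorem toRat_linForm (v : Fin n → Polynomial ℤ) :
    toRat (linForm v) = linForm fun j => algebraMap (Polynomial ℤ) (RatFunc ℤ) (v j) := by
  simp [toRat, linForm]

theorem evalAt_linForm {k : Type*} [CommRing k] (a : Fin n → ℕ) (v : Fin n → Polynomial k) :
    evalAt a (linForm v) = ∑ j, v j * (a j : Polynomial k) := by
  simp [evalAt, linForm]

/-- The transform p ↦ ∑ φ(k, p_k) is additive and the a_j are natural numbers, so it commutes with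
evaluation at A = a. Hence the Hilbert polynomials can be formed before or after evaluating. -/
theorem evalAt_linForm_sum (a : Fin n → ℕ) (v : Fin n → Polynomial ℤ)
    (φ : ℕ → ℤ → Polynomial ℚ) (h0 : ∀ i, φ i 0 = 0)
    (hadd : ∀ i b c, φ i (b + c) = φ i b + φ i c) :
    evalAt a (linForm fun j => (v j).sum φ) = (evalAt a (linForm v)).sum φ := by
  let F : Polynomial ℤ →+ Polynomial ℚ :=
    { toFun := fun p => p.sum φ
      map_zero' := Polynomial.sum_zero_index _
      map_add' := fun p q => Polynomial.sum_add_index p q φ h0 hadd }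
  rw [evalAt_linForm, evalAt_linForm]
  change _ = F _
  rw [map_sum]
  refine Finset.sum_congr rfl fun j _ => ?_
  rw [mul_comm (v j), ← nsmul_eq_mul, map_nsmul, nsmul_eq_mul, mul_comm]
  rfl

end LinearForms

/-! ### The polynomials `h` -/

section HPolynomial

variable {n : ℕ} {U : Set (Fin n →₀ ℕ)}

/-- `z` times the coefficient of `A_j` in the formula for `h` by a Stanley decomposition. -/
def stanleyPolynomial (Ω : Finset ((Fin n →₀ ℕ) × Finset (Fin n))) (j : Fin n) : Polynomial ℤ :=
  ∑ ω ∈ Ω, Polynomial.X ^ ω.1.degree * (1 - Polynomial.X) ^ (2 - ω.2.card) *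
    (Polynomial.X * (zeroOne ω.2 j : Polynomial ℤ) +
      (1 - Polynomial.X) * (ω.1 j : Polynomial ℤ))

/-- The Leibniz rule on each t^σ / ∏_{i∈τ}(1 - t_i) produces a pole of order at most |τ| + 1 ≤ 3,
which (1-z)^3 clears. -/
theorem IsConeDecomposition.coe_stanleyPolynomial
    {Ω : Finset ((Fin n →₀ ℕ) × Finset (Fin n))} (hΩ : IsConeDecomposition Uᶜ Ω)
    (hcard : ∀ ω ∈ Ω, ω.2.card ≤ 2) (j : Fin n) :
    (stanleyPolynomial Ω j : PowerSeries ℤ) =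
      (1 - PowerSeries.X) ^ 3 * momentSeries j (stdIndicator U) := by
  rw [hΩ.stdIndicator_eq, map_sum, Finset.mul_sum, stanleyPolynomial,
    ← Polynomial.coeToPowerSeries.ringHom_apply, map_sum]
  refine Finset.sum_congr rfl fun ω hω => ?_
  obtain ⟨c, hc⟩ := Nat.exists_eq_add_of_le (hcard ω hω)
  have h1 := genSeries_coneIndicator ω.2
  have h2 := momentSeries_coneIndicator j ω.2
  rw [momentSeries_shift]
  simp only [map_mul, map_pow, map_add, map_sub, map_one, map_natCast,
    Polynomial.coeToPowerSeries.ringHom_apply, Polynomial.coe_X]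
  rw [show 2 - ω.2.card = c by omega]
  have h3 : (1 - PowerSeries.X : PowerSeries ℤ) ^ 3 =
      (1 - PowerSeries.X) ^ c * (1 - PowerSeries.X) ^ ω.2.card * (1 - PowerSeries.X) := by
    rw [← pow_add, ← pow_succ]
    congr 1
    omega
  rw [h3]
  rw [pow_succ] at h2
  linear_combination -(PowerSeries.X ^ ω.1.degree * (1 - PowerSeries.X) ^ c) * h2 -
    PowerSeries.X ^ ω.1.degree * (1 - PowerSeries.X) ^ c * (1 - PowerSeries.X) *
      ((ω.1 j : ℕ) : PowerSeries ℤ) * h1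

theorem coeff_zero_momentSeries (j : Fin n) (f : (Fin n →₀ ℕ) → ℤ) :
    PowerSeries.coeff 0 (momentSeries j f) = 0 := by
  rw [momentSeries_apply, coeff_genSeries]
  refine Finset.sum_eq_zero fun m hm => ?_
  rw [mem_exponents, Finsupp.degree_eq_zero_iff] at hm
  simp [hm]

/-- `h` is the polynomial vector with `z h_j = (1 - z) ^ 3 ∑ n_j z ^ |n|`, the sum over the
standard monomials `t ^ n`. -/
def IsHVector (U : Set (Fin n →₀ ℕ)) (h : Fin n → Polynomial ℤ) : Prop :=
  ∀ j, PowerSeries.X * (h j : PowerSeries ℤ) =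
    (1 - PowerSeries.X) ^ 3 * momentSeries j (stdIndicator U)

/-- Any one cone decomposition shows (1-z)^3 M_j to be a polynomial. It is divisible by z because
the monomial 1 contributes nothing to M_j. -/
theorem IsConeDecomposition.exists_isHVector {Ω : Finset ((Fin n →₀ ℕ) × Finset (Fin n))}
    (hΩ : IsConeDecomposition Uᶜ Ω) (hcard : ∀ ω ∈ Ω, ω.2.card ≤ 2) : ∃ h, IsHVector U h := by
  have : ∀ j, ∃ p : Polynomial ℤ, stanleyPolynomial Ω j = Polynomial.X * p := by
    intro j
    refine Polynomial.X_dvd_iff.2 ?_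
    rw [← Polynomial.coeff_coe, hΩ.coe_stanleyPolynomial hcard,
      PowerSeries.coeff_zero_eq_constantCoeff_apply, map_mul,
      ← PowerSeries.coeff_zero_eq_constantCoeff_apply (momentSeries _ _),
      coeff_zero_momentSeries, mul_zero]
  choose h hh using this
  refine ⟨h, fun j => ?_⟩
  rw [← hΩ.coe_stanleyPolynomial hcard, hh, Polynomial.coe_mul, Polynomial.coe_X]

theorem ratFunc_X_ne_zero : (RatFunc.X : RatFunc ℤ) ≠ 0 := by
  rw [← RatFunc.algebraMap_X]
  exact (map_ne_zero_iff _ (RatFunc.algebraMap_injective ℤ)).2 Polynomial.X_ne_zero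

theorem ratFunc_one_sub_X_ne_zero : (1 - RatFunc.X : RatFunc ℤ) ≠ 0 := by
  rw [← RatFunc.algebraMap_X, ← map_one (algebraMap (Polynomial ℤ) (RatFunc ℤ)), ← map_sub]
  refine (map_ne_zero_iff _ (RatFunc.algebraMap_injective ℤ)).2 fun h => ?_
  have := congrArg (Polynomial.coeff · 0) h
  simp at this

theorem IsHVector.toRat_eq_stanleyExpression {h : Fin n → Polynomial ℤ} (hh : IsHVector U h)
    {Ω : Finset ((Fin n →₀ ℕ) × Finset (Fin n))} (hΩ : IsConeDecomposition Uᶜ Ω)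
    (hcard : ∀ ω ∈ Ω, ω.2.card ≤ 2) : toRat (linForm h) = stanleyExpression Ω := by
  rw [toRat_linForm, stanleyExpression, sum_linForm]
  congr 1
  ext1 j
  have h1 : Polynomial.X * h j = stanleyPolynomial Ω j := by
    apply Polynomial.coe_injective
    rw [Polynomial.coe_mul, Polynomial.coe_X, hh j, hΩ.coe_stanleyPolynomial hcard]
  have h2 := congrArg (algebraMap (Polynomial ℤ) (RatFunc ℤ)) h1
  rw [stanleyPolynomial, map_mul, map_sum, RatFunc.algebraMap_X] at h2
  refine mul_left_cancel₀ ratFunc_X_ne_zero (h2.trans ?_)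
  rw [Finset.mul_sum]
  refine Finset.sum_congr rfl fun ω hω => ?_
  have hc : (2 : ℤ) - (ω.2.card : ℤ) = ((2 - ω.2.card : ℕ) : ℤ) := by
    rw [Nat.cast_sub (hcard ω hω)]
    rfl
  rw [hc, zpow_natCast, zpow_sub_one₀ ratFunc_X_ne_zero, zpow_natCast]
  simp only [map_mul, map_pow, map_add, map_sub, map_one, map_natCast, RatFunc.algebraMap_X]
  have hX := ratFunc_X_ne_zero
  field_simp

/-- The generating series of a function with finite support. -/
theorem genSeries_eq_sum (f : (Fin n →₀ ℕ) → ℤ) (A : Finset (Fin n →₀ ℕ))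
    (hA : ∀ m ∉ A, f m = 0) :
    genSeries f = ∑ m ∈ A, PowerSeries.C (f m) * PowerSeries.X ^ m.degree := by
  ext k
  rw [coeff_genSeries, map_sum]
  simp only [PowerSeries.coeff_C_mul, PowerSeries.coeff_X_pow, mul_ite, mul_one, mul_zero]
  rw [← Finset.sum_filter]
  symm
  refine Finset.sum_subset (fun m hm => ?_) fun m hm hm' => hA m fun hmA => hm' ?_
  · rw [mem_exponents]
    exact (Finset.mem_filter.1 hm).2.symm
  · exact Finset.mem_filter.2 ⟨hmA, (mem_exponents.1 hm).symm⟩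

end HPolynomial

/-! ### The formula for h by Betti numbers -/

section Betti

variable {K : Type*} [Field K] {d : ℕ} {I : Ideal (MvPolynomial (Fin (d + 1)) K)}
  {U : Set (Fin (d + 1) →₀ ℕ)}

/-- The terms with i = 0 can be added for free: β_{0,α} = 0 for α ≠ 0, and for α = 0 the factor α_j
is zero. -/
theorem sum_betti_mul (I : Ideal (MvPolynomial (Fin (d + 1)) K)) (A : Finset (Fin (d + 1) →₀ ℕ))
    (g : (Fin (d + 1) →₀ ℕ) → RatFunc ℤ) (j : Fin (d + 1)) :
    ∑ p ∈ (Finset.range (d + 1 + 1) ×ˢ A).filter (fun p => 1 ≤ p.1),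
      (-1) ^ p.1 * (betti I p.1 p.2 : RatFunc ℤ) * g p.2 * (p.2 j : RatFunc ℤ) =
    ∑ α ∈ A, ((∑ i ∈ Finset.range (d + 1 + 1), (-1 : ℤ) ^ i * betti I i α : ℤ) : RatFunc ℤ) *
      g α * (α j : RatFunc ℤ) := by
  rw [Finset.sum_filter, Finset.sum_product_right]
  refine Finset.sum_congr rfl fun α _ => ?_
  rw [Int.cast_sum, Finset.sum_mul, Finset.sum_mul]
  refine Finset.sum_congr rfl fun i _ => ?_
  split_ifs with hi
  · push_cast
    ring
  · obtain rfl : i = 0 := by omega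
    by_cases hα : α = 0
    · simp [hα]
    · simp [betti_zero_eq_zero hα]

/-- The coefficient of `A_j` in the formula for `h` by Betti numbers, cleared of denominators. -/
theorem IsHVector.one_sub_X_sq_mul {h : Fin (d + 1) → Polynomial ℤ} (hh : IsHVector U h)
    (hG : (1 - PowerSeries.X) ^ 2 * genSeries (stdIndicator U) =
      1 + ((d : PowerSeries ℤ) - 1) * PowerSeries.X)
    (A : Finset (Fin (d + 1) →₀ ℕ))
    (hA : ∀ α ∉ A, koszulDifference Finset.univ (stdIndicator U) α = 0) (j : Fin (d + 1)) :
    (1 - Polynomial.X) ^ 2 * ∑ α ∈ A, Polynomial.C ((α j : ℤ) *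
        koszulDifference Finset.univ (stdIndicator U) α) * Polynomial.X ^ α.degree =
      (1 - Polynomial.X) ^ d * Polynomial.X *
        (h j - (1 + ((d : Polynomial ℤ) - 1) * Polynomial.X)) := by
  set χ := koszulDifference Finset.univ (stdIndicator U) with hχ
  set B : Polynomial ℤ := ∑ α ∈ A, Polynomial.C ((α j : ℤ) * χ α) * Polynomial.X ^ α.degree
    with hB
  have hBcoe : (B : PowerSeries ℤ) = momentSeries j χ := by
    rw [momentSeries_apply, genSeries_eq_sum _ A fun α hα => by rw [hA α hα, mul_zero], hB,
      ← Polynomial.coeToPowerSeries.ringHom_apply, map_sum]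
    refine Finset.sum_congr rfl fun α _ => ?_
    rw [Polynomial.coeToPowerSeries.ringHom_apply, Polynomial.coe_mul, Polynomial.coe_C,
      Polynomial.coe_pow, Polynomial.coe_X]
  apply Polynomial.coe_injective
  -- With all d + 1 variables the Leibniz rule reads (1-z) B = (1-z)^(d+2) M_j - z (1-z)^(d+1) H,
  -- where H is the Hilbert series of the standard monomials. One more factor 1 - z turns M_j into z
  -- h_j and H into 1 + (d-1) z.
  have h1 := momentSeries_koszulDifference j Finset.univ (stdIndicator U)
  rw [← hχ, ← hBcoe, Finset.card_univ, Fintype.card_fin, zeroOne_apply,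
    if_pos (Finset.mem_univ j), Nat.cast_one] at h1
  have h2 := hh j
  simp only [← Polynomial.coeToPowerSeries.ringHom_apply, map_mul, map_pow, map_add, map_sub,
    map_one, map_natCast] at h1 h2 ⊢
  simp only [Polynomial.coeToPowerSeries.ringHom_apply, Polynomial.coe_X] at h1 h2 ⊢
  linear_combination (1 - PowerSeries.X) * h1 - (1 - PowerSeries.X) ^ d * h2 -
    PowerSeries.X * (1 - PowerSeries.X) ^ d * hG

theorem sum_mul_zpow_div {F ι : Type*} [Field F] {x y : F} (hx : x ≠ 0) (hy : y ≠ 0) (A : Finset ι)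
    (a c : ι → F) (k : ι → ℕ) (d : ℕ) :
    ∑ i ∈ A, c i * (x ^ ((k i : ℤ) - 1) / y ^ ((d : ℤ) - 2)) * a i =
      y ^ 2 * (∑ i ∈ A, a i * c i * x ^ k i) / (x * y ^ d) := by
  rw [Finset.mul_sum, Finset.sum_div]
  refine Finset.sum_congr rfl fun i _ => ?_
  rw [zpow_sub_one₀ hx, zpow_sub₀ hy, zpow_natCast, zpow_natCast, zpow_ofNat]
  field_simp

theorem IsMonomialOn.bettiExpression_eq (hI : IsMonomialOn I U) :
    ∃ A : Finset (Fin (d + 1) →₀ ℕ),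
      (∀ α ∉ A, koszulDifference Finset.univ (stdIndicator U) α = 0) ∧
      bettiExpression d I = linForm fun j => 1 + ((d : RatFunc ℤ) - 1) * RatFunc.X +
        ∑ α ∈ A, (koszulDifference Finset.univ (stdIndicator U) α : RatFunc ℤ) *
          (RatFunc.X ^ ((α.degree : ℤ) - 1) / (1 - RatFunc.X) ^ ((d : ℤ) - 2)) *
          (α j : RatFunc ℤ) := by
  classical
  let A : Finset (Fin (d + 1) →₀ ℕ) := hI.finite_betti.toFinset.image Prod.snd
  have hA : ∀ i, ∀ α ∉ A, betti I i α = 0 := by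
    intro i α hα
    by_contra hne
    exact hα (Finset.mem_image.2 ⟨(i, α), hI.finite_betti.mem_toFinset.2 hne, rfl⟩)
  have hfin : ∀ g : ℕ × (Fin (d + 1) →₀ ℕ) → MvPolynomial (Fin (d + 1)) (RatFunc ℤ),
      (∀ p, betti I p.1 p.2 = 0 → g p = 0) →
      ∑ᶠ p : {p : ℕ × (Fin (d + 1) →₀ ℕ) // 1 ≤ p.1}, g p =
        ∑ p ∈ (Finset.range (d + 1 + 1) ×ˢ A).filter (fun p => 1 ≤ p.1), g p := by
    intro g hg
    refine (finsum_subtype_eq_finsum_cond _).trans (finsum_cond_eq_sum_of_cond_iff g ?_)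
    intro p hp
    rw [Finset.mem_filter, Finset.mem_product, Finset.mem_range]
    refine ⟨fun h1 => ⟨⟨?_, ?_⟩, h1⟩, fun h1 => h1.2⟩
    · by_contra hlt
      exact hp (hg p (betti_eq_zero_of_lt (by omega) _))
    · by_contra hpA
      exact hp (hg p (hA _ _ hpA))
  refine ⟨A, fun α hα => ?_, ?_⟩
  · rw [← hI.sum_betti]
    exact Finset.sum_eq_zero fun i _ => by rw [hA i α hα, Nat.cast_zero, mul_zero]
  · rw [bettiExpression, hfin (fun p => linForm fun j =>
        (-1) ^ p.1 * (betti I p.1 p.2 : RatFunc ℤ) *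
        (RatFunc.X ^ ((p.2.degree : ℤ) - 1) / (1 - RatFunc.X) ^ ((d : ℤ) - 2)) *
        (p.2 j : RatFunc ℤ)) (fun p hp => by simp [hp, linForm]), sum_linForm, linForm_add]
    congr 1
    ext1 j
    rw [Pi.add_apply, sum_betti_mul I A
      (fun α => RatFunc.X ^ ((α.degree : ℤ) - 1) / (1 - RatFunc.X) ^ ((d : ℤ) - 2))]
    simp only [hI.sum_betti]

theorem IsHVector.toRat_eq_bettiExpression {h : Fin (d + 1) → Polynomial ℤ} (hh : IsHVector U h)
    (hI : IsMonomialOn I U)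
    (hG : (1 - PowerSeries.X) ^ 2 * genSeries (stdIndicator U) =
      1 + ((d : PowerSeries ℤ) - 1) * PowerSeries.X) :
    toRat (linForm h) = bettiExpression d I := by
  obtain ⟨A, hA, hexpr⟩ := hI.bettiExpression_eq
  rw [toRat_linForm, hexpr]
  congr 1
  ext1 j
  have hrat := congrArg (algebraMap (Polynomial ℤ) (RatFunc ℤ)) (hh.one_sub_X_sq_mul hG A hA j)
  simp only [map_mul, map_pow, map_add, map_sub, map_one, map_natCast, map_sum, map_intCast,
    RatFunc.algebraMap_X, eq_intCast] at hrat
  have hX := ratFunc_X_ne_zero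
  have hX1 := ratFunc_one_sub_X_ne_zero
  rw [sum_mul_zpow_div hX hX1, hrat, mul_comm RatFunc.X,
    mul_div_cancel_left₀ _ (mul_ne_zero (pow_ne_zero _ hX1) hX), add_sub_cancel]

end Betti

end GroebnerFan

/-! ### Assembly of the theorem -/

open GroebnerFan in
theorem mainTheorem9 {K : Type*} [Field K] (d : ℕ) (hd : 0 < d)
    (I : Ideal (MvPolynomial (Fin (d + 1)) K))
    (hI : ∃ τ : MonomialOrder.{0, 0} (Fin (d + 1)),
      GroebnerFan.initialIdeal τ (GroebnerFan.rationalNormalCurveIdeal K d) = I) :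
    ∃ (h : MvPolynomial (Fin (d + 1)) (Polynomial ℤ))
      (Q Q₁ : MvPolynomial (Fin (d + 1)) (Polynomial ℚ)),
      h.IsHomogeneous 1 ∧ Q.IsHomogeneous 1 ∧ Q₁.IsHomogeneous 1 ∧
      (∀ τ : MonomialOrder.{0, 0} (Fin (d + 1)),
        GroebnerFan.initialIdeal τ (GroebnerFan.rationalNormalCurveIdeal K d) = I →
        ∀ L : Ideal (MvPolynomial (Fin 2) K),
          GroebnerFan.IsMonomialIdeal L →
          L.radical = MvPolynomial.idealOfVars (Fin 2) K →
          (MvPolynomial.X 0 : MvPolynomial (Fin 2) K) ^ d ∈ L →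
          (fun i => (GroebnerFan.assocSeq d L i : ℚ≥0)) ∈
            GroebnerFan.cone τ (GroebnerFan.rationalNormalCurveIdeal K d) →
          GroebnerFan.IsHPolynomial L
            (GroebnerFan.evalAt (GroebnerFan.assocSeq d L) h) ∧
          GroebnerFan.IsHilbertPolynomial (GroebnerFan.hilbertFun L)
            (GroebnerFan.evalAt (GroebnerFan.assocSeq d L) Q) ∧
          GroebnerFan.IsHilbertPolynomial (GroebnerFan.hilbertFun₁ L)
            (GroebnerFan.evalAt (GroebnerFan.assocSeq d L) Q₁)) ∧
      {p : ℕ × (Fin (d + 1) →₀ ℕ) | GroebnerFan.betti I p.1 p.2 ≠ 0}.Finite ∧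
      GroebnerFan.toRat h = GroebnerFan.bettiExpression d I ∧
      (∃ Ω : Finset ((Fin (d + 1) →₀ ℕ) × Finset (Fin (d + 1))),
        GroebnerFan.IsStanleyDecomposition I Ω) ∧
      (∀ Ω : Finset ((Fin (d + 1) →₀ ℕ) × Finset (Fin (d + 1))),
        GroebnerFan.IsStanleyDecomposition I Ω →
          GroebnerFan.toRat h = GroebnerFan.stanleyExpression Ω) ∧
      Q = GroebnerFan.hilbertExpression h ∧
      Q₁ = GroebnerFan.hilbertExpression₁ h := by
  obtain ⟨τ₀, rfl⟩ := hI
  have hmon := isMonomialOn_initialIdeal (K := K) τ₀ hd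
  have hcard : ∀ {Ω : Finset ((Fin (d + 1) →₀ ℕ) × Finset (Fin (d + 1)))},
      IsConeDecomposition (leadSet d τ₀)ᶜ Ω → ∀ ω ∈ Ω, ω.2.card ≤ 2 :=
    fun hΩ ω hω => card_le_two_of_coneSet_subset τ₀ (hΩ.1 ω hω)
  obtain ⟨Ω₀, hΩ₀⟩ := exists_isConeDecomposition_compl (isUpperSet_leadSet τ₀)
  obtain ⟨h, hh⟩ := hΩ₀.exists_isHVector (hcard hΩ₀)
  refine ⟨linForm h, hilbertExpression (linForm h), hilbertExpression₁ (linForm h),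
    isHomogeneous_linForm _, isHomogeneous_linForm _, isHomogeneous_linForm _, ?_,
    hmon.finite_betti, hh.toRat_eq_bettiExpression hmon (genSeries_stdIndicator τ₀),
    ⟨Ω₀, hmon.isStanleyDecomposition hΩ₀⟩, fun Ω hΩ => ?_, rfl, rfl⟩
  · rintro τ hτ L ⟨s, hs⟩ hrad hx hcone
    have hL := isMonomialOn_span (K := K) s
    rw [← hs] at hL
    -- The polynomials were built from τ₀, but the cone condition may use another term order with
    -- the same initial ideal; the standard monomials depend only on that ideal.
    have hlead : leadSet d τ = leadSet d τ₀ := by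
      ext m
      rw [← (isMonomialOn_initialIdeal (K := K) τ hd).monomial_mem, hτ, hmon.monomial_mem]
    have hmin := isMinimalWeight_of_mem_cone hd hcone
    set a := assocSeq d L with ha
    have hH : IsHPolynomial L (evalAt a (linForm h)) := by
      have h1 := X_mul_mk_hilbertFun₁ hL hrad hx hmin
      rw [hlead] at h1
      refine mul_left_cancel₀ PowerSeries.X_ne_zero ?_
      rw [mul_left_comm, h1, evalAt_linForm, ← Polynomial.coeToPowerSeries.ringHom_apply, map_sum,
        Finset.mul_sum, Finset.mul_sum]
      refine Finset.sum_congr rfl fun j _ => ?_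
      rw [map_mul, map_natCast, Polynomial.coeToPowerSeries.ringHom_apply]
      linear_combination (a j : PowerSeries ℤ) * hh j
    refine ⟨hH, ?_, ?_⟩
    · simp only [hilbertExpression, coeff_linForm]
      rw [evalAt_linForm_sum a h _ (by simp) (by intros; push_cast [map_add]; ring)]
      -- The coefficients of (1-z) ∑ H¹(L, k) z^k are consecutive differences of dim R/L^(k+1),
      -- which for k ≥ 1 are the dimensions of L^k/L^(k+1).
      refine isHilbertPolynomial_of_square
        (G := (1 - PowerSeries.X) * PowerSeries.mk fun k => (hilbertFun₁ L k : ℤ)) ?_ ?_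
      · rw [hH]
        ring
      · refine Filter.eventually_atTop.2 ⟨1, fun k hk => ?_⟩
        obtain ⟨k, rfl⟩ := Nat.exists_eq_succ_of_ne_zero (by omega : k ≠ 0)
        have h1 := hilbertFun_succ hL hrad hx hmin k
        rw [sub_mul, one_mul, map_sub, PowerSeries.coeff_succ_X_mul, PowerSeries.coeff_mk,
          PowerSeries.coeff_mk]
        have h2 : hilbertFun L k.succ + hilbertFun₁ L k = hilbertFun₁ L k.succ := h1
        omega
    · simp only [hilbertExpression₁, coeff_linForm]
      rw [evalAt_linForm_sum a h _ (by simp) (by intros; push_cast [map_add, add_div]; ring)]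
      exact isHilbertPolynomial_of_cube hH
  · have hcd := hmon.isConeDecomposition hΩ
    exact hh.toRat_eq_stanleyExpression hcd (hcard hcd)

end
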